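/- Let $\mathcal B$ be a bicartesian closed category, i.e. a category with chosen finite products $\times$, $I$, chosen finite coproducts $+$, $O$, and for each object $A$ a chosen right adjoint $A\to(-)$ of $A\times(-)$. **Functors.** Consider the formal expressions generated from $1$, $I$, $O$ by binary $\otimes,\oplus,\to$. Such an $F$ has one argument place for each occurrence of $1$; the place of $1$ is positive, signs are kept by $\otimes$ and $\oplus$, and in $F\to G$ the signs of the places of $F$ are reversed. $F$ denotes a functor $\mathcal B^{l_1}\times\dots\times\mathcal B^{l_m}\to\mathcal B$ ($\mathcal B^{+}=\mathcal B$, $\mathcal B^{-}=\mathcal B^{op}$): $1$ is the identity functor, $I$ and $O$ are constants, and $\otimes,\oplus,\to$ apply $\times,+,\to$ to functors of disjoint lists of arguments. **Transformations.** A graph from $F$ to $G$ is given by a finite set $K$ (its components) and a map $\pi$ from the places of $F$ (left-hand) and of $G$ (right-hand) to $K$. Two places of the same component are joined by an edge iff they lie on the same side with opposite signs or on different sides with equal signs; a component without such an edge has one additional vertex, joined to all of its places. (A component may have no places.) A transformation from $F$ to $G$ is a graph together with morphisms $\alpha(A):F(A\circ\pi)\to G(A\circ\pi)$, one for each family $A:K\to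 \mathrm{Ob}(\mathcal B)$. It is *g-dinatural with respect to its graph* if for every $c\in K$, every choice of the objects $A_k$ ($k\ne c$) and every $f:X\to Y$ in $\mathcal B$ $$G\langle 1_Y,f\rangle\circ\alpha(A[c:=Y])\circ F\langle f,1_Y\rangle=G\langle f,1_X\rangle\circ\alpha(A[c:=X])\circ F\langle 1_X,f\rangle ,$$ where $\langle u,v\rangle$ has $u$ in the positive and $v$ in the negative places of the component $c$, and identities in all other places. **Operations.** $\alpha\otimes\beta$, $\alpha\oplus\beta$ and $\alpha\to\beta$ (from $G\to H$ to $F\to J$, for $\alpha:F\to G$, $\beta:H\to J$) are formed by applying $\times,+,\to$ to the members; the graph is the disjoint union, with the graph of $\alpha$ inverted in the last case. For $\alpha:F\to G$ and $\beta:G\to H$, the components of the graph of $\beta\alpha$ are the components of the amalgamation, i.e. of the two graphs glued along the places of $G$; the members are $\beta(\cdot)\circ\alpha(\cdot)$, with the same object assigned to all components of the two graphs that lie in one component of the amalgamation. Compositions of more than two transformations are associated to the right. **Primitive transformations.** For all $F,G,H$ these are the identity $1_F$; $\delta_F:F\otimes I\to F$ and its inverse $\delta^i_F$; $b^{\to}_{F,G,H}:F\otimes(G\otimes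 H)\to(F\otimes G)\otimes H$ and its inverse $b^{\leftarrow}_{F,G,H}$; the symmetry $c_{F,G}:F\otimes G\to G\otimes F$; the diagonal $w_F:F\to F\otimes F$; $k_F:F\to I$; the codiagonal $m_F:F\oplus F\to F$; $l_F:O\to F$; the injections $l^1_{F,G}:F\to F\oplus G$ and $l^2_{F,G}:G\to F\oplus G$; the evaluation $\varepsilon_{F,G}:F\otimes(F\to G)\to G$ and the coevaluation $\eta_{F,G}:G\to(F\to(F\otimes G))$. The members are the corresponding morphisms of $\mathcal B$. The components are indexed by the places of each of the letters among $F,G,H$ that index the transformation, and all copies of the same place of the same letter lie in one component. For a transformation $\beta$ let $C(\beta)$ be the least set that contains $\beta$ and is closed under $\gamma\mapsto\gamma\otimes 1_F$ and $\gamma\mapsto 1_F\otimes\gamma$ for all $F$. Let $$\xi_{F,G,H}=\varepsilon_{F,K}\bigl(1_F\otimes m_{F\to K}\bigl((1_F\to l^1_{F\otimes G,F\otimes H})\,\eta_{F,G}\oplus(1_F\to l^2_{F\otimes G,F\otimes H})\,\eta_{F,H}\bigr)\bigr),\qquad K=(F\otimes G)\oplus(F\otimes H),$$ a transformation from $F\otimes(G\oplus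 H)$ to $K$ (composition binds more strongly than $\otimes,\oplus,\to$). **Constructible transformations** form the least class such that: 1. primitive transformations are constructible; 2. if $\alpha:F\to G$ is in $C(\beta)$ for some $\beta$ among $b^{\leftarrow},b^{\to},c,w,k,\delta,\delta^i$ (with any indices) and $\gamma:G\to H$ is constructible, then so is $\gamma\alpha$; 3. if $\alpha,\beta$ are constructible, so is $\alpha\otimes\beta$; 4. if $\alpha:F\otimes G\to H$ and $\beta:J\otimes G\to H$ are constructible, so is $m_H(\alpha\oplus\beta)(c_{G,F}\oplus c_{G,J})\,\xi_{G,F,J}\,c_{F\oplus J,G}$; 5. if $\alpha:F\to G$ is constructible, so are $l^1_{G,H}\alpha$ and $l^2_{H,G}\alpha$, for every $H$; 6. if $\alpha:F\otimes G\to H$ is constructible, so is $(1_F\to\alpha)\,\eta_{F,G}$; 7. if $\alpha:F\to G$ and $\beta:H\otimes J\to T$ are constructible, so is $\beta\bigl((\varepsilon_{G,H}(\alpha\otimes 1_{G\to H}))\otimes 1_J\bigr)$. **Lemma.** Every constructible transformation in $\mathcal B$ is g-dinatural with respect to its own graph. -/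

import Mathlib

open CategoryTheory MonoidalCategory CartesianMonoidalCategory Limits

universe v u

/-! ### Bicartesian closed categories

Finite products and exponentials are Mathlib's `CartesianMonoidalCategory` and `MonoidalClosed`
(a right adjoint of every `A ⊗ -`).  Finite coproducts are a chosen structure as well. -/

/-- A choice of an initial object and of binary coproducts. -/
class ChosenFiniteCoproducts (B : Type u) [Category.{v} B] where
  zero : B
  zeroIsInitial : IsInitial zero
  sum : B → B → B
  inl (X Y : B) : X ⟶ sum X Y
  inr (X Y : B) : Y ⟶ sum X Y
  sumIsCoproduct (X Y : B) : IsColimit (BinaryCofan.mk (inl X Y) (inr X Y))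

namespace GDinat

/-! ### Signs and functors of mixed variance -/

/-- The variance of an argument place. -/
inductive Sign : Type
  | pos
  | neg

/-- The opposite sign. -/
def Sign.flip : Sign → Sign
  | .pos => .neg
  | .neg => .pos

section Mixed

variable {B : Type u} [Category.{v} B]

/-- Morphisms of `B` (sign `pos`) or of `Bᵒᵖ` (sign `neg`) from `X` to `Y`. -/
def SHom : Sign → B → B → Type v
  | .pos, X, Y => X ⟶ Y
  | .neg, X, Y => Y ⟶ X

/-- Identity of `B` or `Bᵒᵖ`. -/
def SHom.id : (s : Sign) → (X : B) → SHom s X X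
  | .pos, X => 𝟙 X
  | .neg, X => 𝟙 X

/-- Composition (in diagrammatic order) in `B` or `Bᵒᵖ`. -/
def SHom.comp : {s : Sign} → {X Y Z : B} → SHom s X Y → SHom s Y Z → SHom s X Z
  | .pos, _, _, _, f, g => CategoryStruct.comp (obj := B) f g
  | .neg, _, _, _, f, g => CategoryStruct.comp (obj := B) g f

/-- A morphism of the opposite variance, read backwards. -/
def SHom.flip : {s : Sign} → {X Y : B} → SHom s.flip X Y → SHom s Y X
  | .pos, _, _, f => f
  | .neg, _, _, f => f

theorem SHom.id_comp {s : Sign} {X Y : B} (f : SHom s X Y) : (SHom.id s X).comp f = f := by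
  cases s
  · exact Category.id_comp (obj := B) f
  · exact Category.comp_id (obj := B) f

theorem SHom.comp_id {s : Sign} {X Y : B} (f : SHom s X Y) : f.comp (SHom.id s Y) = f := by
  cases s
  · exact Category.comp_id (obj := B) f
  · exact Category.id_comp (obj := B) f

theorem SHom.assoc {s : Sign} {W X Y Z : B} (f : SHom s W X) (g : SHom s X Y) (h : SHom s Y Z) :
    (f.comp g).comp h = f.comp (g.comp h) := by
  cases s
  · exact Category.assoc (obj := B) f g h
  · exact (Category.assoc (obj := B) h g f).symm

theorem SHom.flip_id (s : Sign) (X : B) : (SHom.id s.flip X).flip = SHom.id s X := by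
  cases s <;> rfl

theorem SHom.flip_comp {s : Sign} {X Y Z : B} (f : SHom s.flip X Y) (g : SHom s.flip Y Z) :
    (f.comp g).flip = g.flip.comp f.flip := by
  cases s <;> rfl

end Mixed

/-- The product category `∏ p, B^{s p}` with `B^{pos} = B` and `B^{neg} = Bᵒᵖ`: an object is a
tuple of objects of `B`, a morphism is a tuple of morphisms of `B`, reversed at the negative
places. -/
def SPow {P : Type} (_ : P → Sign) (B : Type u) : Type u := P → B

instance {P : Type} (s : P → Sign) (B : Type u) [Category.{v} B] : Category.{v} (SPow s B) where
  Hom X Y := ∀ p, SHom (s p) (X p) (Y p)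
  id X p := SHom.id (s p) (X p)
  comp f g p := (f p).comp (g p)
  id_comp _ := funext fun _ => SHom.id_comp _
  comp_id _ := funext fun _ => SHom.comp_id _
  assoc _ _ _ := funext fun _ => SHom.assoc _ _ _

/-! ### Graphs -/

/-- A graph with left-hand argument places `P` (of signs `s`) and right-hand argument places `Q`
(of signs `t`).  It is given by its finite set of components and its component classifier; the
remaining vertices and the edges, which these data determine, are `GVertex` and `edges` below.
A component without argument places (a lone vertex of `GVertex`) can arise by composition. -/
structure Graph {P Q : Type} (s : P → Sign) (t : Q → Sign) where
  /-- the set of components -/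
  Comp : Type
  finite_comp : Finite Comp
  /-- the component of an argument place -/
  cls : P ⊕ Q → Comp

namespace Graph

variable {P Q : Type} {s : P → Sign} {t : Q → Sign}

/-- The component of a left-hand argument place. -/
abbrev left (Γ : Graph s t) (p : P) : Γ.Comp := Γ.cls (Sum.inl p)

/-- The component of a right-hand argument place. -/
abbrev right (Γ : Graph s t) (q : Q) : Γ.Comp := Γ.cls (Sum.inr q)

/-- Two argument places are linkable if they lie on the same side and have opposite signs, or lie
on different sides and have equal signs. -/
def Linkable (s : P → Sign) (t : Q → Sign) : P ⊕ Q → P ⊕ Q → Prop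
  | .inl p, .inl p' => s p ≠ s p'
  | .inr q, .inr q' => t q ≠ t q'
  | .inl p, .inr q => s p = t q
  | .inr q, .inl p => s p = t q

theorem Linkable.symm {a b : P ⊕ Q} (h : Linkable s t a b) : Linkable s t b a := by
  rcases a with a | a <;> rcases b with b | b <;> simp only [Linkable] at h ⊢
  · exact h.symm
  · exact h
  · exact h
  · exact h.symm

theorem linkable_or {a b : P ⊕ Q} (h : Linkable s t a b) (x : P ⊕ Q) :
    Linkable s t x a ∨ Linkable s t x b := by
  have h1 : ∀ i j k : Sign, i ≠ j → k ≠ i ∨ k ≠ j := by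
    intro i j k; cases i <;> cases j <;> cases k <;> simp
  have h2 : ∀ i j k : Sign, i ≠ j → k = i ∨ k = j := by
    intro i j k; cases i <;> cases j <;> cases k <;> simp
  have h3 : ∀ i j k : Sign, i = j → k ≠ i ∨ k = j := by
    intro i j k; cases i <;> cases j <;> cases k <;> simp
  have h4 : ∀ i j k : Sign, i = j → k = i ∨ k ≠ j := by
    intro i j k; cases i <;> cases j <;> cases k <;> simp
  rcases a with a | a <;> rcases b with b | b <;> rcases x with x | x <;>
    simp only [Linkable] at h ⊢
  · exact h1 _ _ _ h
  · exact (h2 _ _ _ h).imp Eq.symm Eq.symm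
  · exact h3 _ _ _ h
  · exact (h4 _ _ _ h).imp Eq.symm id
  · exact h4 _ _ _ h.symm
  · exact (h3 _ _ _ h.symm).imp id Eq.symm
  · exact h2 _ _ _ h
  · exact h1 _ _ _ h

/-- The component `c` contains an edge between two argument places. -/
def HasLink (Γ : Graph s t) (c : Γ.Comp) : Prop :=
  ∃ a b : P ⊕ Q, Γ.cls a = c ∧ Γ.cls b = c ∧ Linkable s t a b

/-- The additional vertices: one for each component without edges between argument places. -/
def GVertex (Γ : Graph s t) : Type := {c : Γ.Comp // ¬ Γ.HasLink c}

/-- All vertices. -/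
abbrev Vertex (Γ : Graph s t) : Type := (P ⊕ Q) ⊕ Γ.GVertex

/-- The component of a vertex. -/
def classOf (Γ : Graph s t) : Γ.Vertex → Γ.Comp
  | .inl a => Γ.cls a
  | .inr g => g.1

/-- The edges: linkable argument places of the same component are joined, and an additional vertex
is joined to all argument places of its component. -/
def edges (Γ : Graph s t) : SimpleGraph Γ.Vertex where
  Adj u w := Γ.classOf u = Γ.classOf w ∧
    match u, w with
    | .inl a, .inl b => Linkable s t a b
    | .inl _, .inr _ => True
    | .inr _, .inl _ => True
    | .inr _, .inr _ => False
  symm := ⟨by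
    rintro (_ | _) (_ | _) ⟨h, h'⟩ <;> refine ⟨h.symm, ?_⟩ <;> try exact h'
    exact Linkable.symm h'⟩
  loopless := ⟨by
    rintro (a | a) ⟨_, h'⟩
    · rcases a with a | a <;> simp [Linkable] at h'
    · exact h'⟩

/-- The fibres of the classifier are the connected components of the graph. -/
theorem reachable_iff (Γ : Graph s t) (u w : Γ.Vertex) :
    Γ.edges.Reachable u w ↔ Γ.classOf u = Γ.classOf w := by
  constructor
  · rintro ⟨walk⟩
    induction walk with
    | nil => rfl
    | cons h _ ih => exact h.1.trans ih
  · intro h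
    by_cases hl : Γ.HasLink (Γ.classOf w)
    · obtain ⟨a, b, ha, hb, hab⟩ := hl
      have hadj : Γ.edges.Reachable (.inl b) (.inl a) :=
        SimpleGraph.Adj.reachable (G := Γ.edges) ⟨hb.trans ha.symm, hab.symm⟩
      have key : ∀ x : Γ.Vertex, Γ.classOf x = Γ.classOf w → Γ.edges.Reachable x (.inl a) := by
        rintro (x | ⟨x, hx⟩) hxw
        · rcases linkable_or hab x with hx | hx
          · exact SimpleGraph.Adj.reachable (G := Γ.edges) ⟨hxw.trans ha.symm, hx⟩
          · exact (SimpleGraph.Adj.reachable (G := Γ.edges) (v := .inl b)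
              ⟨hxw.trans hb.symm, hx⟩).trans hadj
        · exact absurd ⟨a, b, ha.trans hxw.symm, hb.trans hxw.symm, hab⟩ hx
      exact (key u h).trans (key w rfl).symm
    · have key : ∀ x : Γ.Vertex, Γ.classOf x = Γ.classOf w →
          Γ.edges.Reachable x (.inr ⟨Γ.classOf w, hl⟩) := by
        rintro (x | ⟨x, hx⟩) hxw
        · exact SimpleGraph.Adj.reachable (G := Γ.edges) ⟨hxw, trivial⟩
        · obtain rfl : x = Γ.classOf w := hxw
          exact SimpleGraph.Reachable.refl _
      exact (key u h).trans (key w rfl).symm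

/-- Every component contains a vertex. -/
theorem classOf_surjective (Γ : Graph s t) : Function.Surjective Γ.classOf := by
  intro c
  by_cases h : Γ.HasLink c
  · obtain ⟨a, _, ha, _⟩ := h
    exact ⟨.inl a, ha⟩
  · exact ⟨.inr ⟨c, h⟩, rfl⟩

end Graph

/-! ### g-dinatural transformations -/

/-- `X` at a positive and `Y` at a negative argument place. -/
def pick {B : Type u} : Sign → B → B → B
  | .pos, X, _ => X
  | .neg, _, Y => Y

section GDinatural

variable {B : Type u} [Category.{v} B]

/-- The entries of `⟨f, 𝟙 Y⟩ : ⟨X, Y⟩ ⟶ ⟨Y, Y⟩`. -/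
def pickToNeg {X Y : B} (f : X ⟶ Y) : (s : Sign) → SHom s (pick s X Y) Y
  | .pos => f
  | .neg => 𝟙 Y

/-- The entries of `⟨𝟙 X, f⟩ : ⟨X, Y⟩ ⟶ ⟨X, X⟩`. -/
def pickToPos {X Y : B} (f : X ⟶ Y) : (s : Sign) → SHom s (pick s X Y) X
  | .pos => 𝟙 X
  | .neg => f

/-- The entries of `⟨𝟙 Y, f⟩ : ⟨Y, Y⟩ ⟶ ⟨Y, X⟩`. -/
def negToPick {X Y : B} (f : X ⟶ Y) : (s : Sign) → SHom s Y (pick s Y X)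
  | .pos => 𝟙 Y
  | .neg => f

/-- The entries of `⟨f, 𝟙 X⟩ : ⟨X, X⟩ ⟶ ⟨Y, X⟩`. -/
def posToPick {X Y : B} (f : X ⟶ Y) : (s : Sign) → SHom s X (pick s Y X)
  | .pos => f
  | .neg => 𝟙 X

open Classical in
/-- The family of morphisms that is `f` at the index `c` and the identity at all others. -/
noncomputable def updateHom {K : Type} (A : K → B) (c : K) {X Y : B} (f : X ⟶ Y) (k : K) :
    Function.update A c X k ⟶ Function.update A c Y k :=
  if h : k = c then
    eqToHom (by rw [h, Function.update_self]) ≫ f ≫ eqToHom (by rw [h, Function.update_self])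
  else
    eqToHom (by rw [Function.update_of_ne h, Function.update_of_ne h])

variable {P Q : Type} {s : P → Sign} {t : Q → Sign}

/-- A transformation from `T` to `S` along the graph `Γ`: a family of morphisms indexed by the
tuples of objects of `B`, one object for each component of `Γ`. -/
def Family (T : SPow s B ⥤ B) (S : SPow t B ⥤ B) (Γ : Graph s t) : Type (max u v) :=
  ∀ A : Γ.Comp → B, T.obj (fun p => A (Γ.left p)) ⟶ S.obj (fun q => A (Γ.right q))

/-- For a family `g k : U k ⟶ W k` indexed by the components, the commutativity of the hexagon
`T⟨g, 𝟙⟩ ≫ α W ≫ S⟨𝟙, g⟩ = T⟨𝟙, g⟩ ≫ α U ≫ S⟨g, 𝟙⟩` from `T⟨U, W⟩` to `S⟨W, U⟩`. -/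
def Hexagon {T : SPow s B ⥤ B} {S : SPow t B ⥤ B} (Γ : Graph s t) (α : Family T S Γ)
    (U W : Γ.Comp → B) (g : ∀ k, U k ⟶ W k) : Prop :=
  let TUW : SPow s B := fun p => pick (s p) (U (Γ.left p)) (W (Γ.left p))
  let SWU : SPow t B := fun q => pick (t q) (W (Γ.right q)) (U (Γ.right q))
  let TU : SPow s B := fun p => U (Γ.left p)
  let TW : SPow s B := fun p => W (Γ.left p)
  let SU : SPow t B := fun q => U (Γ.right q)
  let SW : SPow t B := fun q => W (Γ.right q)
  let tW : TUW ⟶ TW := fun p => pickToNeg (g (Γ.left p)) (s p)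
  let tU : TUW ⟶ TU := fun p => pickToPos (g (Γ.left p)) (s p)
  let sW : SW ⟶ SWU := fun q => negToPick (g (Γ.right q)) (t q)
  let sU : SU ⟶ SWU := fun q => posToPick (g (Γ.right q)) (t q)
  T.map tW ≫ α W ≫ S.map sW = T.map tU ≫ α U ≫ S.map sU

open Classical in
/-- g-dinaturality with the graph `Γ`, componentwise.  For every component `c`, every choice of
objects `A k` in the other components and every `f : X ⟶ Y`, the hexagon commutes for
`U = A[c ↦ X]`, `W = A[c ↦ Y]`, where `f` is put into the component `c` and all argument places
outside of `c` carry identities. -/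
def IsGDinatural {T : SPow s B ⥤ B} {S : SPow t B ⥤ B} (Γ : Graph s t) (α : Family T S Γ) : Prop :=
  ∀ (c : Γ.Comp) (A : Γ.Comp → B) (X Y : B) (f : X ⟶ Y),
    Hexagon Γ α (Function.update A c X) (Function.update A c Y) (updateHom A c f)

end GDinatural

/-! ### The objects of the functor category -/

/-- The formal expressions for the functors built from `1`, `I`, `O` by `⊗`, `⊕` and `→`. -/
inductive Shape : Type
  | var
  | unit
  | zero
  | tensor (F G : Shape)
  | plus (F G : Shape)
  | arrow (F G : Shape)

namespace Shape

/-- The argument places of a functor. -/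
@[reducible]
def Place : Shape → Type
  | var => Unit
  | unit => Empty
  | zero => Empty
  | tensor F G => F.Place ⊕ G.Place
  | plus F G => F.Place ⊕ G.Place
  | arrow F G => F.Place ⊕ G.Place

/-- The signs of the argument places. -/
def sign : (F : Shape) → F.Place → Sign
  | var => fun _ => .pos
  | unit => Empty.elim
  | zero => Empty.elim
  | tensor F G => Sum.elim F.sign G.sign
  | plus F G => Sum.elim F.sign G.sign
  | arrow F G => Sum.elim (fun p => (F.sign p).flip) G.sign

instance finite_place : (F : Shape) → Finite F.Place
  | var => inferInstanceAs (Finite Unit)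
  | unit => inferInstanceAs (Finite Empty)
  | zero => inferInstanceAs (Finite Empty)
  | tensor F G =>
    haveI := F.finite_place; haveI := G.finite_place; inferInstanceAs (Finite (F.Place ⊕ G.Place))
  | plus F G =>
    haveI := F.finite_place; haveI := G.finite_place; inferInstanceAs (Finite (F.Place ⊕ G.Place))
  | arrow F G =>
    haveI := F.finite_place; haveI := G.finite_place; inferInstanceAs (Finite (F.Place ⊕ G.Place))

end Shape

variable {B : Type u} [Category.{v} B]

/-- `f + g` on morphisms. -/
def sumMap [ChosenFiniteCoproducts B] {X X' Y Y' : B} (f : X ⟶ X') (g : Y ⟶ Y') :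
    ChosenFiniteCoproducts.sum X Y ⟶ ChosenFiniteCoproducts.sum X' Y' :=
  BinaryCofan.IsColimit.desc (ChosenFiniteCoproducts.sumIsCoproduct X Y)
    (f ≫ ChosenFiniteCoproducts.inl X' Y') (g ≫ ChosenFiniteCoproducts.inr X' Y')

/-- The codiagonal. -/
def codiag [ChosenFiniteCoproducts B] (X : B) : ChosenFiniteCoproducts.sum X X ⟶ X :=
  BinaryCofan.IsColimit.desc (ChosenFiniteCoproducts.sumIsCoproduct X X) (𝟙 X) (𝟙 X)

theorem sumMap_id [ChosenFiniteCoproducts B] (X Y : B) : sumMap (𝟙 X) (𝟙 Y) = 𝟙 _ := by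
  apply BinaryCofan.IsColimit.hom_ext (ChosenFiniteCoproducts.sumIsCoproduct X Y)
  · exact (BinaryCofan.IsColimit.inl_desc _ _ _).trans
      ((Category.id_comp _).trans (Category.comp_id _).symm)
  · exact (BinaryCofan.IsColimit.inr_desc _ _ _).trans
      ((Category.id_comp _).trans (Category.comp_id _).symm)

theorem inl_sumMap [ChosenFiniteCoproducts B] {X X' Y Y' : B} (f : X ⟶ X') (g : Y ⟶ Y') :
    ChosenFiniteCoproducts.inl X Y ≫ sumMap f g = f ≫ ChosenFiniteCoproducts.inl X' Y' :=
  BinaryCofan.IsColimit.inl_desc (ChosenFiniteCoproducts.sumIsCoproduct X Y) _ _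

theorem inr_sumMap [ChosenFiniteCoproducts B] {X X' Y Y' : B} (f : X ⟶ X') (g : Y ⟶ Y') :
    ChosenFiniteCoproducts.inr X Y ≫ sumMap f g = g ≫ ChosenFiniteCoproducts.inr X' Y' :=
  BinaryCofan.IsColimit.inr_desc (ChosenFiniteCoproducts.sumIsCoproduct X Y) _ _

theorem sumMap_comp [ChosenFiniteCoproducts B] {X X' X'' Y Y' Y'' : B} (f : X ⟶ X')
    (f' : X' ⟶ X'') (g : Y ⟶ Y') (g' : Y' ⟶ Y'') :
    sumMap (f ≫ f') (g ≫ g') = sumMap f g ≫ sumMap f' g' := by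
  apply BinaryCofan.IsColimit.hom_ext (ChosenFiniteCoproducts.sumIsCoproduct X Y)
  · change ChosenFiniteCoproducts.inl X Y ≫ _ = ChosenFiniteCoproducts.inl X Y ≫ _
    rw [inl_sumMap, ← Category.assoc, inl_sumMap, Category.assoc, Category.assoc, inl_sumMap]
  · change ChosenFiniteCoproducts.inr X Y ≫ _ = ChosenFiniteCoproducts.inr X Y ≫ _
    rw [inr_sumMap, ← Category.assoc, inr_sumMap, Category.assoc, Category.assoc, inr_sumMap]

/-- `f → g` on morphisms. -/
def arrowMap [CartesianMonoidalCategory B] [MonoidalClosed B] {X X' Y Y' : B}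
    (f : X' ⟶ X) (g : Y ⟶ Y') : (ihom X).obj Y ⟶ (ihom X').obj Y' :=
  (MonoidalClosed.pre f).app Y ≫ (ihom X').map g

theorem arrowMap_id [CartesianMonoidalCategory B] [MonoidalClosed B] (X Y : B) :
    arrowMap (𝟙 X) (𝟙 Y) = 𝟙 _ := by
  simp [arrowMap]

theorem arrowMap_comp [CartesianMonoidalCategory B] [MonoidalClosed B] {X X' X'' Y Y' Y'' : B}
    (f : X'' ⟶ X') (f' : X' ⟶ X) (g : Y ⟶ Y') (g' : Y' ⟶ Y'') :
    arrowMap (f ≫ f') (g ≫ g') = arrowMap f' g ≫ arrowMap f g' := by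
  simp [arrowMap, MonoidalClosed.pre_map]

section ShapeFunctor

variable [CartesianMonoidalCategory B] [MonoidalClosed B] [ChosenFiniteCoproducts B]

namespace Shape

/-- The value of a functor on objects. -/
def eval : (F : Shape) → (F.Place → B) → B
  | var => fun X => X ()
  | unit => fun _ => 𝟙_ B
  | zero => fun _ => ChosenFiniteCoproducts.zero
  | tensor F G => fun X => F.eval (fun p => X (.inl p)) ⊗ G.eval (fun q => X (.inr q))
  | plus F G => fun X =>
      ChosenFiniteCoproducts.sum (F.eval fun p => X (.inl p)) (G.eval fun q => X (.inr q))
  | arrow F G => fun X => (ihom (F.eval fun p => X (.inl p))).obj (G.eval fun q => X (.inr q))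

/-- The value of a functor on morphisms. -/
def evalMap : (F : Shape) → {X Y : F.Place → B} → (∀ p, SHom (F.sign p) (X p) (Y p)) →
    (F.eval X ⟶ F.eval Y)
  | var, _, _ => fun f => f ()
  | unit, _, _ => fun _ => 𝟙 _
  | zero, _, _ => fun _ => 𝟙 _
  | tensor F G, _, _ => fun f =>
      F.evalMap (fun p => f (.inl p)) ⊗ₘ G.evalMap (fun q => f (.inr q))
  | plus F G, _, _ => fun f =>
      sumMap (F.evalMap fun p => f (.inl p)) (G.evalMap fun q => f (.inr q))
  | arrow F G, X, Y => fun f =>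
      arrowMap (F.evalMap (X := fun p => Y (.inl p)) (Y := fun p => X (.inl p))
        fun p => SHom.flip (f (.inl p))) (G.evalMap fun q => f (.inr q))

theorem evalMap_id : (F : Shape) → (X : F.Place → B) →
    F.evalMap (fun p => SHom.id (F.sign p) (X p)) = 𝟙 (F.eval X)
  | var, X => rfl
  | unit, X => rfl
  | zero, X => rfl
  | tensor F G, X => by
      have hF := F.evalMap_id (fun p => X (.inl p))
      have hG := G.evalMap_id (fun p => X (.inr p))
      exact (congrArg₂ (fun a b => a ⊗ₘ b) hF hG).trans (id_tensorHom_id _ _)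
  | plus F G, X => by
      have hF := F.evalMap_id (fun p => X (.inl p))
      have hG := G.evalMap_id (fun p => X (.inr p))
      exact (congrArg₂ sumMap hF hG).trans (sumMap_id _ _)
  | arrow F G, X => by
      have hF := F.evalMap_id (fun p => X (.inl p))
      have hG := G.evalMap_id (fun p => X (.inr p))
      have hf : (fun p => SHom.flip (SHom.id (F.sign p).flip (X (.inl p)))) =
        fun p => SHom.id (F.sign p) (X (.inl p)) := funext fun p => SHom.flip_id _ _
      exact (congrArg₂ arrowMap ((congrArg _ hf).trans hF) hG).trans (arrowMap_id _ _)

theorem evalMap_comp : (F : Shape) → {X Y Z : F.Place → B} →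
    (f : ∀ p, SHom (F.sign p) (X p) (Y p)) → (g : ∀ p, SHom (F.sign p) (Y p) (Z p)) →
    F.evalMap (fun p => (f p).comp (g p)) = F.evalMap f ≫ F.evalMap g
  | var, _, _, _, f, g => rfl
  | unit, _, _, _, f, g => (Category.id_comp _).symm
  | zero, _, _, _, f, g => (Category.id_comp _).symm
  | tensor F G, _, _, _, f, g => by
      have hF := F.evalMap_comp (fun p => f (.inl p)) (fun p => g (.inl p))
      have hG := G.evalMap_comp (fun p => f (.inr p)) (fun p => g (.inr p))
      exact (congrArg₂ (fun a b => a ⊗ₘ b) hF hG).trans (tensorHom_comp_tensorHom _ _ _ _).symm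
  | plus F G, _, _, _, f, g => by
      have hF := F.evalMap_comp (fun p => f (.inl p)) (fun p => g (.inl p))
      have hG := G.evalMap_comp (fun p => f (.inr p)) (fun p => g (.inr p))
      exact (congrArg₂ sumMap hF hG).trans (sumMap_comp _ _ _ _)
  | arrow F G, X, Y, Z, f, g => by
      have hF := F.evalMap_comp (X := fun p => Z (.inl p)) (Y := fun p => Y (.inl p))
        (Z := fun p => X (.inl p)) (fun p => SHom.flip (g (.inl p)))
        (fun p => SHom.flip (f (.inl p)))
      have hG := G.evalMap_comp (fun p => f (.inr p)) (fun p => g (.inr p))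
      have hf : (fun p => SHom.flip ((f (.inl p)).comp (g (.inl p)))) =
        fun p => (SHom.flip (g (.inl p))).comp (SHom.flip (f (.inl p))) :=
          funext fun p => SHom.flip_comp _ _
      exact (congrArg₂ arrowMap ((congrArg _ hf).trans hF) hG).trans (arrowMap_comp _ _ _ _)

/-- The functor `B^{l₁} × ⋯ × B^{lₘ} ⥤ B` denoted by a formal expression. -/
def functor (F : Shape) (B : Type u) [Category.{v} B] [CartesianMonoidalCategory B]
    [MonoidalClosed B] [ChosenFiniteCoproducts B] : SPow F.sign B ⥤ B where
  obj X := F.eval X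
  map f := F.evalMap f
  map_id X := F.evalMap_id X
  map_comp f g := F.evalMap_comp f g

end Shape

end ShapeFunctor

/-! ### Transformations between the functors, and the operations on them -/

section Transformations

variable (B) [CartesianMonoidalCategory B] [MonoidalClosed B] [ChosenFiniteCoproducts B]

/-- A family of morphisms from `F` to `G` together with its graph. -/
structure CTrans (F G : Shape) where
  graph : Graph F.sign G.sign
  app : Family (F.functor B) (G.functor B) graph

/-- The transformation is g-dinatural with respect to its own graph. -/
def CTrans.GDinatural {B : Type u} [Category.{v} B] [CartesianMonoidalCategory B]
    [MonoidalClosed B] [ChosenFiniteCoproducts B] {F G : Shape} (α : CTrans B F G) : Prop :=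
  IsGDinatural α.graph α.app

namespace CTrans

open Shape

/-! #### Primitive transformations

In each of them the components of the graph are indexed by the entries of the tuples `A⃗`, `B⃗`, `C⃗`
of objects, and every argument place belongs to the component of the entry it takes. -/

/-- `1_F : F → F`. -/
def one (F : Shape) : CTrans B F F where
  graph := ⟨F.Place, inferInstance, Sum.elim id id⟩
  app A := 𝟙 (F.eval A)

/-- `δ_F : F ⊗ I → F`. -/
def delta (F : Shape) : CTrans B (tensor F unit) F where
  graph := ⟨F.Place, inferInstance, Sum.elim (Sum.elim id Empty.elim) id⟩
  app A := (ρ_ (F.eval A)).hom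

/-- `δⁱ_F : F → F ⊗ I`. -/
def deltaInv (F : Shape) : CTrans B F (tensor F unit) where
  graph := ⟨F.Place, inferInstance, Sum.elim id (Sum.elim id Empty.elim)⟩
  app A := (ρ_ (F.eval A)).inv

/-- `b^→_{F,G,H} : F ⊗ (G ⊗ H) → (F ⊗ G) ⊗ H`. -/
def assoc (F G H : Shape) : CTrans B (tensor F (tensor G H)) (tensor (tensor F G) H) where
  graph := ⟨F.Place ⊕ (G.Place ⊕ H.Place), inferInstance,
    Sum.elim id (Equiv.sumAssoc F.Place G.Place H.Place)⟩
  app A := (α_ (F.eval fun p => A (.inl p)) (G.eval fun p => A (.inr (.inl p)))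
    (H.eval fun p => A (.inr (.inr p)))).inv

/-- `b^←_{F,G,H} : (F ⊗ G) ⊗ H → F ⊗ (G ⊗ H)`. -/
def assocInv (F G H : Shape) : CTrans B (tensor (tensor F G) H) (tensor F (tensor G H)) where
  graph := ⟨F.Place ⊕ (G.Place ⊕ H.Place), inferInstance,
    Sum.elim (Equiv.sumAssoc F.Place G.Place H.Place) id⟩
  app A := (α_ (F.eval fun p => A (.inl p)) (G.eval fun p => A (.inr (.inl p)))
    (H.eval fun p => A (.inr (.inr p)))).hom

/-- `c_{F,G} : F ⊗ G → G ⊗ F`. -/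
def swap (F G : Shape) : CTrans B (tensor F G) (tensor G F) where
  graph := ⟨F.Place ⊕ G.Place, inferInstance, Sum.elim id Sum.swap⟩
  app A := lift (snd (F.eval fun p => A (.inl p)) (G.eval fun p => A (.inr p)))
    (fst (F.eval fun p => A (.inl p)) (G.eval fun p => A (.inr p)))

/-- `w_F : F → F ⊗ F`. -/
def diag (F : Shape) : CTrans B F (tensor F F) where
  graph := ⟨F.Place, inferInstance, Sum.elim id (Sum.elim id id)⟩
  app A := lift (𝟙 (F.eval A)) (𝟙 (F.eval A))

/-- `k_F : F → I`. -/
def toUnit (F : Shape) : CTrans B F unit where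
  graph := ⟨F.Place, inferInstance, Sum.elim id Empty.elim⟩
  app A := SemiCartesianMonoidalCategory.toUnit (F.eval A)

/-- `m_F : F ⊕ F → F`. -/
def codiag (F : Shape) : CTrans B (plus F F) F where
  graph := ⟨F.Place, inferInstance, Sum.elim (Sum.elim id id) id⟩
  app A := GDinat.codiag (F.eval A)

/-- `l_F : O → F`. -/
def ofZero (F : Shape) : CTrans B zero F where
  graph := ⟨F.Place, inferInstance, Sum.elim Empty.elim id⟩
  app A := ChosenFiniteCoproducts.zeroIsInitial.to (F.eval A)

/-- `l¹_{F,G} : F → F ⊕ G`. -/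
def inl (F G : Shape) : CTrans B F (plus F G) where
  graph := ⟨F.Place ⊕ G.Place, inferInstance, Sum.elim Sum.inl id⟩
  app A := ChosenFiniteCoproducts.inl (F.eval fun p => A (.inl p)) (G.eval fun p => A (.inr p))

/-- `l²_{F,G} : G → F ⊕ G`. -/
def inr (F G : Shape) : CTrans B G (plus F G) where
  graph := ⟨F.Place ⊕ G.Place, inferInstance, Sum.elim Sum.inr id⟩
  app A := ChosenFiniteCoproducts.inr (F.eval fun p => A (.inl p)) (G.eval fun p => A (.inr p))

/-- `ε_{F,G} : F ⊗ (F → G) → G`. -/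
def ev (F G : Shape) : CTrans B (tensor F (arrow F G)) G where
  graph := ⟨F.Place ⊕ G.Place, inferInstance, Sum.elim (Sum.elim Sum.inl id) Sum.inr⟩
  app A := (ihom.ev (F.eval fun p => A (.inl p))).app (G.eval fun p => A (.inr p))

/-- `η_{F,G} : G → (F → F ⊗ G)`. -/
def coev (F G : Shape) : CTrans B G (arrow F (tensor F G)) where
  graph := ⟨F.Place ⊕ G.Place, inferInstance, Sum.elim Sum.inr (Sum.elim Sum.inl id)⟩
  app A := (ihom.coev (F.eval fun p => A (.inl p))).app (G.eval fun p => A (.inr p))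

/-! #### Operations -/

variable {B} {F G H J : Shape}

/-- `α ⊗ β : F ⊗ H → G ⊗ J`, with the disjoint union of the graphs. -/
def tensor (α : CTrans B F G) (β : CTrans B H J) :
    CTrans B (Shape.tensor F H) (Shape.tensor G J) where
  graph := ⟨α.graph.Comp ⊕ β.graph.Comp,
    haveI := α.graph.finite_comp; haveI := β.graph.finite_comp; inferInstance,
    Sum.elim (Sum.map α.graph.left β.graph.left) (Sum.map α.graph.right β.graph.right)⟩
  app A := α.app (fun c => A (.inl c)) ⊗ₘ β.app (fun c => A (.inr c))

/-- `α ⊕ β : F ⊕ H → G ⊕ J`, with the disjoint union of the graphs. -/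
def plus (α : CTrans B F G) (β : CTrans B H J) : CTrans B (Shape.plus F H) (Shape.plus G J) where
  graph := ⟨α.graph.Comp ⊕ β.graph.Comp,
    haveI := α.graph.finite_comp; haveI := β.graph.finite_comp; inferInstance,
    Sum.elim (Sum.map α.graph.left β.graph.left) (Sum.map α.graph.right β.graph.right)⟩
  app A := sumMap (α.app (fun c => A (.inl c))) (β.app (fun c => A (.inr c)))

/-- `α → β : (G → H) → (F → J)`, with the disjoint union of the inverted graph of `α` and the
graph of `β`. -/
def arrow (α : CTrans B F G) (β : CTrans B H J) : CTrans B (Shape.arrow G H) (Shape.arrow F J) where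
  graph := ⟨α.graph.Comp ⊕ β.graph.Comp,
    haveI := α.graph.finite_comp; haveI := β.graph.finite_comp; inferInstance,
    Sum.elim (Sum.map α.graph.right β.graph.left) (Sum.map α.graph.left β.graph.right)⟩
  app A := arrowMap (α.app (fun c => A (.inl c))) (β.app (fun c => A (.inr c)))

end CTrans

/-! #### Composition -/

/-- The components of `Φ` and of `Ψ` that share a middle argument place. -/
inductive Graph.Shares {P Q R : Type} {s : P → Sign} {t : Q → Sign} {r : R → Sign}
    (Φ : Graph s t) (Ψ : Graph t r) : Φ.Comp ⊕ Ψ.Comp → Φ.Comp ⊕ Ψ.Comp → Prop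
  | middle (q : Q) : Graph.Shares Φ Ψ (.inl (Φ.right q)) (.inr (Ψ.left q))

/-- The composition `ΨΦ`: its components are those of the amalgamation `Φ + Ψ`, that is, the
components of `Φ` and `Ψ` glued along the middle argument places. -/
def Graph.comp {P Q R : Type} {s : P → Sign} {t : Q → Sign} {r : R → Sign}
    (Ψ : Graph t r) (Φ : Graph s t) : Graph s r where
  Comp := Quot (Graph.Shares Φ Ψ)
  finite_comp :=
    haveI := Φ.finite_comp; haveI := Ψ.finite_comp
    Finite.of_surjective (Quot.mk _) Quot.mk_surjective
  cls := Sum.elim (fun p => Quot.mk _ (.inl (Φ.left p))) (fun q => Quot.mk _ (.inr (Ψ.right q)))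

variable {B} {F G H : Shape}

/-- The composition `βα`: the morphisms `β(A, …) ∘ α(A, …)`, where all components of the two graphs
that lie in the same component of the amalgamation take the same object. -/
def CTrans.comp (β : CTrans B G H) (α : CTrans B F G) : CTrans B F H where
  graph := β.graph.comp α.graph
  app A :=
    α.app (fun c => A (Quot.mk _ (.inl c))) ≫
      eqToHom (congrArg (G.functor B).obj
        (funext fun q => congrArg A (Quot.sound (Graph.Shares.middle q)))) ≫
      β.app (fun c => A (Quot.mk _ (.inr c)))

/-! ### Constructible transformations -/

/-- The transformation `ξ_{F,G,H} : F ⊗ (G ⊕ H) → (F ⊗ G) ⊕ (F ⊗ H)`,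
`ε (1 ⊗ m ((1 → l¹) η ⊕ (1 → l²) η))`. -/
def CTrans.xi (B : Type u) [Category.{v} B] [CartesianMonoidalCategory B]
    [MonoidalClosed B] [ChosenFiniteCoproducts B] (F G H : Shape) :
    CTrans B (.tensor F (.plus G H)) (.plus (.tensor F G) (.tensor F H)) :=
  (ev B F (.plus (.tensor F G) (.tensor F H))).comp
    ((one B F).tensor
      ((codiag B (.arrow F (.plus (.tensor F G) (.tensor F H)))).comp
        ((((one B F).arrow (inl B (.tensor F G) (.tensor F H))).comp (coev B F G)).plus
          (((one B F).arrow (inr B (.tensor F G) (.tensor F H))).comp (coev B F H)))))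

/-- The primitive canonical transformations. -/
inductive Primitive : {F G : Shape} → CTrans B F G → Prop
  | one (F : Shape) : Primitive (CTrans.one B F)
  | delta (F : Shape) : Primitive (CTrans.delta B F)
  | deltaInv (F : Shape) : Primitive (CTrans.deltaInv B F)
  | assoc (F G H : Shape) : Primitive (CTrans.assoc B F G H)
  | assocInv (F G H : Shape) : Primitive (CTrans.assocInv B F G H)
  | swap (F G : Shape) : Primitive (CTrans.swap B F G)
  | diag (F : Shape) : Primitive (CTrans.diag B F)
  | toUnit (F : Shape) : Primitive (CTrans.toUnit B F)
  | codiag (F : Shape) : Primitive (CTrans.codiag B F)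
  | ofZero (F : Shape) : Primitive (CTrans.ofZero B F)
  | inl (F G : Shape) : Primitive (CTrans.inl B F G)
  | inr (F G : Shape) : Primitive (CTrans.inr B F G)
  | ev (F G : Shape) : Primitive (CTrans.ev B F G)
  | coev (F G : Shape) : Primitive (CTrans.coev B F G)

/-- The structural primitive transformations `b^←, b^→, c, w, k, δ, δⁱ`. -/
inductive Structural : {F G : Shape} → CTrans B F G → Prop
  | delta (F : Shape) : Structural (CTrans.delta B F)
  | deltaInv (F : Shape) : Structural (CTrans.deltaInv B F)
  | assoc (F G H : Shape) : Structural (CTrans.assoc B F G H)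
  | assocInv (F G H : Shape) : Structural (CTrans.assocInv B F G H)
  | swap (F G : Shape) : Structural (CTrans.swap B F G)
  | diag (F : Shape) : Structural (CTrans.diag B F)
  | toUnit (F : Shape) : Structural (CTrans.toUnit B F)

/-- `Whiskered β α`: the transformation `α` belongs to the set `C(β)`, obtained from `β` by
repeatedly tensoring with identity transformations on either side. -/
inductive Whiskered {M N : Shape} (β : CTrans B M N) : {F G : Shape} → CTrans B F G → Prop
  | base : Whiskered β β
  | right {F G : Shape} {α : CTrans B F G} (K : Shape) :
      Whiskered β α → Whiskered β (α.tensor (CTrans.one B K))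
  | left {F G : Shape} {α : CTrans B F G} (K : Shape) :
      Whiskered β α → Whiskered β ((CTrans.one B K).tensor α)

/-- The constructible canonical transformations. -/
inductive Constructible : {F G : Shape} → CTrans B F G → Prop
  | primitive {F G : Shape} {α : CTrans B F G} : Primitive α → Constructible α
  | structural {M N F G H : Shape} {β : CTrans B M N} {α : CTrans B F G} {γ : CTrans B G H} :
      Structural β → Whiskered β α → Constructible γ → Constructible (γ.comp α)
  | tensor {F G H J : Shape} {α : CTrans B F G} {β : CTrans B H J} :
      Constructible α → Constructible β → Constructible (α.tensor β)
  | cases {F G H J : Shape} {α : CTrans B (.tensor F G) H} {β : CTrans B (.tensor J G) H} :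
      Constructible α → Constructible β →
      Constructible ((CTrans.codiag B H).comp ((α.plus β).comp
        (((CTrans.swap B G F).plus (CTrans.swap B G J)).comp
          ((CTrans.xi B G F J).comp (CTrans.swap B (.plus F J) G)))))
  | inl {F G : Shape} (H : Shape) {α : CTrans B F G} :
      Constructible α → Constructible ((CTrans.inl B G H).comp α)
  | inr {F G : Shape} (H : Shape) {α : CTrans B F G} :
      Constructible α → Constructible ((CTrans.inr B H G).comp α)
  | curry {F G H : Shape} {α : CTrans B (.tensor F G) H} :
      Constructible α →
      Constructible (((CTrans.one B F).arrow α).comp (CTrans.coev B F G))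
  | apply {F G H J T : Shape} {α : CTrans B F G} {β : CTrans B (.tensor H J) T} :
      Constructible α → Constructible β →
      Constructible (β.comp
        (((CTrans.ev B G H).comp (α.tensor (CTrans.one B (.arrow G H)))).tensor (CTrans.one B J)))

end Transformations

end GDinat

/-! Hexagons do not compose in general, so a direct induction on g-dinaturality fails. There are two
obstacles.

The first is that a component of a composite may consist of several components of the two
constituents. A single arrow placed there has to be inserted into all of them at once. The induction
therefore proves the stronger property `CTrans.Full`: the hexagon commutes for every family of
arrows `U k ⟶ W k` indexed by the components. Such a family on a composite restricts to families on
the constituents that agree at the middle places. The original statement is the case of a family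
that is the identity away from one component (`Full.gDinatural`).

The second is that two hexagons side by side cannot be pasted. A hexagon can, however, be extended
by a genuine naturality square. If the transformation applied first extends to a map `F⟨U, W⟩ ⟶ G⟨U,
W⟩` (`Pre`), or the one applied last extends to a map `F⟨W, U⟩ ⟶ G⟨W, U⟩` (`Post`), then the
composite is again `Full` (`Pre.comp_full`, `Full.comp_post`). The construction rules compose almost
only in this way. Structural transformations and their tensors with identities are `Pre`; so is `ξ`,
being natural in its three arguments (`pre_xi`). The injections and the codiagonal are `Post`.

The remaining rules, currying and application, involve the unit and the evaluation, which are only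
dinatural in the exponent. There the whole composite is treated at once. Passing to `F → G` reverses
the signs of `F`, so transposition or evaluation places the maps of a hexagon before and after the
member of the given transformation. The hexagon to be proved then becomes the given one inside a
fixed context (`Full.curry`, `Full.apply`). -/

namespace GDinat

/-! ### Exponentials -/

section Exponential

variable {B : Type u} [Category.{v} B] [CartesianMonoidalCategory B] [MonoidalClosed B]

/-- Both sides are the transpose of `(f ⊗ₘ g) ≫ k`. This combines naturality of the unit in `Y` with
its dinaturality in `X`. -/
theorem coev_arrowMap {X X' Y Y' Z : B} (f : X' ⟶ X) (g : Y' ⟶ Y) (k : X ⊗ Y ⟶ Z) :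
    g ≫ (ihom.coev X).app Y ≫ arrowMap f k =
      (ihom.coev X').app Y' ≫ (ihom X').map ((f ⊗ₘ g) ≫ k) := by
  apply MonoidalClosed.uncurry_injective
  simp only [MonoidalClosed.uncurry_eq, arrowMap, MonoidalCategory.whiskerLeft_comp,
    Category.assoc, ihom.ev_naturality, MonoidalClosed.id_tensor_pre_app_comp_ev_assoc]
  simp only [MonoidalCategory.tensorHom_def]
  simp [whisker_exchange_assoc]

theorem tensorHom_arrowMap_ev {X X' Y Y' W : B} (f : W ⟶ X') (g : X' ⟶ X) (k : Y ⟶ Y') :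
    (f ⊗ₘ arrowMap g k) ≫ (ihom.ev X').app Y' = ((f ≫ g) ⊗ₘ 𝟙 _) ≫ (ihom.ev X).app Y ≫ k := by
  simp only [MonoidalCategory.tensorHom_def, arrowMap, MonoidalCategory.whiskerLeft_comp,
    Category.assoc, ihom.ev_naturality, MonoidalClosed.id_tensor_pre_app_comp_ev_assoc]
  simp

/-- Evaluation lets the contravariant map `g` pass from the exponential to the other factor, where
it joins `f`. The map `k` leaves room for a transport of the exponent. -/
theorem tensorHom_comp_arrowMap_ev {X X' X'' Y Y' Z V : B} (f : X ⟶ X') (g : X' ⟶ X'')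
    (k : V ⟶ (ihom X'').obj Y) (l : Y ⟶ Y') (m : Y' ⟶ Z) :
    (f ⊗ₘ (k ≫ arrowMap g l)) ≫ (ihom.ev X').app Y' ≫ m =
      ((f ≫ g) ⊗ₘ k) ≫ (ihom.ev X'').app Y ≫ l ≫ m := by
  have h : f ⊗ₘ (k ≫ arrowMap g l) = (𝟙 _ ⊗ₘ k) ≫ (f ⊗ₘ arrowMap g l) := by
    rw [tensorHom_comp_tensorHom, Category.id_comp]
  rw [h, Category.assoc, reassoc_of% (tensorHom_arrowMap_ev f g l),
    tensorHom_comp_tensorHom_assoc, Category.id_comp, Category.comp_id]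

/-- Rewrites one side of the hexagon for the application rule so that `a ≫ ψ ≫ g` and `(l ⊗ₘ j) ≫ ψ'
≫ t` appear as blocks. These are sides of the hexagons of the two given transformations. -/
theorem comp_ev_tensor_comp {Fm Ft Gt Go Hm Ht Jm Jt Tt To V : B} (a : Fm ⟶ Ft) (ψ : Ft ⟶ Gt)
    (g : Gt ⟶ Go) (l : Hm ⟶ Ht) (k : V ⟶ (ihom Go).obj Hm) (j : Jm ⟶ Jt) (ψ' : Ht ⊗ Jt ⟶ Tt)
    (t : Tt ⟶ To)
    (e : Gt ⊗ (ihom Gt).obj Ht = Gt ⊗ (ihom Gt).obj Ht) (e' : Ht ⊗ Jt = Ht ⊗ Jt) :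
    ((a ⊗ₘ (k ≫ arrowMap g l)) ⊗ₘ j) ≫
      ((((ψ ⊗ₘ 𝟙 _) ≫ eqToHom e ≫ (ihom.ev Gt).app Ht) ⊗ₘ 𝟙 _) ≫ eqToHom e' ≫ ψ') ≫ t =
    ((((a ≫ ψ ≫ g) ⊗ₘ k) ≫ (ihom.ev Go).app Hm) ⊗ₘ 𝟙 _) ≫ (l ⊗ₘ j) ≫ ψ' ≫ t := by
  have h : (a ⊗ₘ (k ≫ arrowMap g l)) ≫ (ψ ⊗ₘ 𝟙 _) ≫ (ihom.ev Gt).app Ht =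
      ((a ≫ ψ ≫ g) ⊗ₘ k) ≫ (ihom.ev Go).app Hm ≫ l := by
    rw [tensorHom_comp_tensorHom_assoc, Category.comp_id]
    simpa using tensorHom_comp_arrowMap_ev (a ≫ ψ) g k l (𝟙 _)
  simp only [eqToHom_refl, Category.id_comp, Category.assoc, tensorHom_comp_tensorHom_assoc,
    Category.comp_id, h]

theorem comp_coev_arrowMap {X X' Y Y' Z V : B} (f : X' ⟶ X) (g : Y' ⟶ Y) (k : X ⊗ Y ⟶ Z)
    (e : (ihom X').obj Z = V) :
    g ≫ (ihom.coev X).app Y ≫ arrowMap f k ≫ eqToHom e =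
      (ihom.coev X').app Y' ≫ (ihom X').map ((f ⊗ₘ g) ≫ k) ≫ eqToHom e := by
  subst e
  simp only [eqToHom_refl, Category.comp_id, coev_arrowMap]

/-- Rewrites one side of the hexagon for the currying rule as the transpose of `(a ⊗ₘ g) ≫ ψ ≫ l`,
which is a side of the hexagon of the uncurried transformation. -/
theorem comp_coev_arrowMap_comp {Fm Ft Gm Gt Ht Ho V : B} (a : Fm ⟶ Ft) (g : Gm ⟶ Gt)
    (ψ : Ft ⊗ Gt ⟶ Ht) (l : Ht ⟶ Ho)
    (e : (ihom Ft).obj (Ft ⊗ Gt) = (ihom Ft).obj (Ft ⊗ Gt)) (e' : (ihom Fm).obj Ho = V) :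
    g ≫ ((ihom.coev Ft).app Gt ≫ eqToHom e ≫ arrowMap (𝟙 _) ψ) ≫ arrowMap a l ≫ eqToHom e' =
    (ihom.coev Fm).app Gm ≫ (ihom Fm).map ((a ⊗ₘ g) ≫ ψ ≫ l) ≫ eqToHom e' := by
  rw [← comp_coev_arrowMap, ← Category.comp_id a, arrowMap_comp]
  simp only [eqToHom_refl, Category.id_comp, Category.assoc, Category.comp_id]

theorem coev_arrowMap_ev {X Y Z : B} (f : X ⊗ Y ⟶ Z) :
    X ◁ ((ihom.coev X).app Y ≫ arrowMap (𝟙 X) f) ≫ (ihom.ev X).app Z = f := by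
  simp [arrowMap]

end Exponential

/-! ### Hexagons of families of arrows -/

theorem pick_flip {B : Type u} (s : Sign) (X Y : B) : pick s.flip X Y = pick s Y X := by
  cases s <;> rfl

section Pick

variable {B : Type u} [Category.{v} B] {X Y : B} (f : X ⟶ Y)

/-- Heterogeneous equality is needed because `pick s.flip X Y` and `pick s Y X` become
definitionally equal only once the sign is known. -/
theorem flip_pickToNeg (s : Sign) : SHom.flip (pickToNeg f s.flip) ≍ negToPick f s := by
  cases s <;> rfl

theorem flip_pickToPos (s : Sign) : SHom.flip (pickToPos f s.flip) ≍ posToPick f s := by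
  cases s <;> rfl

theorem flip_negToPick (s : Sign) : SHom.flip (negToPick f s.flip) ≍ pickToNeg f s := by
  cases s <;> rfl

theorem flip_posToPick (s : Sign) : SHom.flip (posToPick f s.flip) ≍ pickToPos f s := by
  cases s <;> rfl

theorem pickToNeg_comp_negToPick (s : Sign) :
    (pickToNeg f s).comp (negToPick f s) = (pickToPos f s).comp (posToPick f s) := by
  cases s
  · exact (Category.comp_id (obj := B) f).trans (Category.id_comp (obj := B) f).symm
  · exact (Category.comp_id (obj := B) f).trans (Category.id_comp (obj := B) f).symm

end Pick

variable {B : Type u} [Category.{v} B] [CartesianMonoidalCategory B] [MonoidalClosed B]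
  [ChosenFiniteCoproducts B]

namespace Shape

/-- `F⟨U, W⟩` for a family of arrows `U ⟶ W`. -/
abbrev inMix (F : Shape) (x : F.Place → Arrow B) : B :=
  F.eval fun p => pick (F.sign p) (x p).left (x p).right

/-- `F⟨W, U⟩` for a family of arrows `U ⟶ W`. -/
abbrev outMix (F : Shape) (x : F.Place → Arrow B) : B :=
  F.eval fun p => pick (F.sign p) (x p).right (x p).left

/-- The value of `F` at the domains. -/
abbrev src (F : Shape) (x : F.Place → Arrow B) : B := F.eval fun p => (x p).left

/-- The value of `F` at the codomains. -/
abbrev tgt (F : Shape) (x : F.Place → Arrow B) : B := F.eval fun p => (x p).right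

/-- `F⟨g, 𝟙⟩ : F⟨U, W⟩ ⟶ F⟨W, W⟩`. -/
def toTgt (F : Shape) (x : F.Place → Arrow B) : F.inMix x ⟶ F.tgt x :=
  F.evalMap fun p => pickToNeg (x p).hom (F.sign p)

/-- `F⟨𝟙, g⟩ : F⟨U, W⟩ ⟶ F⟨U, U⟩`. -/
def toSrc (F : Shape) (x : F.Place → Arrow B) : F.inMix x ⟶ F.src x :=
  F.evalMap fun p => pickToPos (x p).hom (F.sign p)

/-- `F⟨𝟙, g⟩ : F⟨W, W⟩ ⟶ F⟨W, U⟩`. -/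
def fromTgt (F : Shape) (x : F.Place → Arrow B) : F.tgt x ⟶ F.outMix x :=
  F.evalMap fun p => negToPick (x p).hom (F.sign p)

/-- `F⟨g, 𝟙⟩ : F⟨U, U⟩ ⟶ F⟨W, U⟩`. -/
def fromSrc (F : Shape) (x : F.Place → Arrow B) : F.src x ⟶ F.outMix x :=
  F.evalMap fun p => posToPick (x p).hom (F.sign p)

/-- At every place both composites are the given arrow itself. This is the hexagon of the identity,
and the square to which the other naturality arguments reduce. -/
theorem toTgt_fromTgt (F : Shape) (x : F.Place → Arrow B) :
    F.toTgt x ≫ F.fromTgt x = F.toSrc x ≫ F.fromSrc x := by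
  refine (F.evalMap_comp _ _).symm.trans (Eq.trans ?_ (F.evalMap_comp _ _))
  exact congrArg _ (funext fun p => pickToNeg_comp_negToPick _ _)

/-! ### Mixed values of exponential shapes -/

section Arrow

variable (F G : Shape) (x : (arrow F G).Place → Arrow B)

theorem inMix_arrow_eq : (arrow F G).inMix x =
    (ihom (F.outMix fun p => x (.inl p))).obj (G.inMix fun q => x (.inr q)) :=
  congrArg (fun M => (ihom (F.eval M)).obj (G.inMix fun q => x (.inr q)))
    (funext fun _ => pick_flip _ _ _)

theorem outMix_arrow_eq : (ihom (F.inMix fun p => x (.inl p))).obj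
    (G.outMix fun q => x (.inr q)) = (arrow F G).outMix x :=
  congrArg (fun M => (ihom (F.eval M)).obj (G.outMix fun q => x (.inr q)))
    (funext fun _ => (pick_flip _ _ _).symm)

theorem arrowMap_evalMap_in {M M' Y : F.Place → B} (h : M = M')
    (m : ∀ p, SHom (F.sign p) (Y p) (M p)) (m' : ∀ p, SHom (F.sign p) (Y p) (M' p))
    (hm : ∀ p, m p ≍ m' p) {Z Z' : B} (g : Z ⟶ Z')
    (e : (ihom (F.eval M)).obj Z = (ihom (F.eval M')).obj Z) :
    arrowMap (F.evalMap m) g = eqToHom e ≫ arrowMap (F.evalMap m') g := by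
  subst h
  obtain rfl : m = m' := funext fun p => eq_of_heq (hm p)
  simp

theorem arrowMap_evalMap_out {M M' Y : F.Place → B} (h : M = M')
    (m : ∀ p, SHom (F.sign p) (M p) (Y p)) (m' : ∀ p, SHom (F.sign p) (M' p) (Y p))
    (hm : ∀ p, m p ≍ m' p) {Z Z' : B} (g : Z ⟶ Z')
    (e : (ihom (F.eval M')).obj Z' = (ihom (F.eval M)).obj Z') :
    arrowMap (F.evalMap m) g = arrowMap (F.evalMap m') g ≫ eqToHom e := by
  subst h
  obtain rfl : m = m' := funext fun p => eq_of_heq (hm p)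
  simp

/-- The places of `F` change sign inside `F → G`, so a map out of the mixed value on the left of a
hexagon is built from a map into the mixed value of `F` on the right. This exchange lets the hexagon
of a transformation into `F` close up under evaluation. -/
theorem toTgt_arrow : (arrow F G).toTgt x = eqToHom (inMix_arrow_eq F G x) ≫
    arrowMap (F.fromTgt fun p => x (.inl p)) (G.toTgt fun q => x (.inr q)) :=
  arrowMap_evalMap_in F (funext fun _ => pick_flip _ _ _) _ _
    (fun _ => flip_pickToNeg _ _) _ _

theorem toSrc_arrow : (arrow F G).toSrc x = eqToHom (inMix_arrow_eq F G x) ≫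
    arrowMap (F.fromSrc fun p => x (.inl p)) (G.toSrc fun q => x (.inr q)) :=
  arrowMap_evalMap_in F (funext fun _ => pick_flip _ _ _) _ _
    (fun _ => flip_pickToPos _ _) _ _

theorem fromTgt_arrow : (arrow F G).fromTgt x =
    arrowMap (F.toTgt fun p => x (.inl p)) (G.fromTgt fun q => x (.inr q)) ≫
      eqToHom (outMix_arrow_eq F G x) :=
  arrowMap_evalMap_out F (funext fun _ => pick_flip _ _ _) _ _
    (fun _ => flip_negToPick _ _) _ _

theorem fromSrc_arrow : (arrow F G).fromSrc x =
    arrowMap (F.toSrc fun p => x (.inl p)) (G.fromSrc fun q => x (.inr q)) ≫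
      eqToHom (outMix_arrow_eq F G x) :=
  arrowMap_evalMap_out F (funext fun _ => pick_flip _ _ _) _ _
    (fun _ => flip_posToPick _ _) _ _

end Arrow

end Shape

/-! ### Hexagons, one-sided naturality, and their stability under the operations -/

section Hex

variable {F G H J T : Shape}

/-- The hexagon for the members `φ` and `ψ` of a transformation at the domains and at the codomains
of a family of arrows. -/
def Hex (x : F.Place → Arrow B) (y : G.Place → Arrow B) (φ : F.src x ⟶ G.src y)
    (ψ : F.tgt x ⟶ G.tgt y) : Prop :=
  F.toTgt x ≫ ψ ≫ G.fromTgt y = F.toSrc x ≫ φ ≫ G.fromSrc y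

/-- The members `φ` and `ψ` extend to a morphism `F⟨U, W⟩ ⟶ G⟨U, W⟩`. -/
def PreNat (x : F.Place → Arrow B) (y : G.Place → Arrow B) (φ : F.src x ⟶ G.src y)
    (ψ : F.tgt x ⟶ G.tgt y) : Prop :=
  ∃ χ : F.inMix x ⟶ G.inMix y,
    F.toTgt x ≫ ψ = χ ≫ G.toTgt y ∧ F.toSrc x ≫ φ = χ ≫ G.toSrc y

/-- The members `φ` and `ψ` extend to a morphism `F⟨W, U⟩ ⟶ G⟨W, U⟩`. -/
def PostNat (x : F.Place → Arrow B) (y : G.Place → Arrow B) (φ : F.src x ⟶ G.src y)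
    (ψ : F.tgt x ⟶ G.tgt y) : Prop :=
  ∃ χ : F.outMix x ⟶ G.outMix y,
    ψ ≫ G.fromTgt y = F.fromTgt x ≫ χ ∧ φ ≫ G.fromSrc y = F.fromSrc x ≫ χ

theorem PreNat.hex {x : F.Place → Arrow B} {y : G.Place → Arrow B} {φ : F.src x ⟶ G.src y}
    {ψ : F.tgt x ⟶ G.tgt y} : PreNat x y φ ψ → Hex x y φ ψ := by
  rintro ⟨χ, h, h'⟩
  rw [Hex, reassoc_of% h, reassoc_of% h', Shape.toTgt_fromTgt]

theorem PostNat.hex {x : F.Place → Arrow B} {y : G.Place → Arrow B} {φ : F.src x ⟶ G.src y}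
    {ψ : F.tgt x ⟶ G.tgt y} : PostNat x y φ ψ → Hex x y φ ψ := by
  rintro ⟨χ, h, h'⟩
  rw [Hex, h, h', ← Category.assoc, ← Category.assoc, Shape.toTgt_fromTgt]

section Comp

variable {x : F.Place → Arrow B} {y y' : G.Place → Arrow B} {z : H.Place → Arrow B}
  {φ : F.src x ⟶ G.src y} {ψ : F.tgt x ⟶ G.tgt y} {φ' : G.src y' ⟶ H.src z}
  {ψ' : G.tgt y' ⟶ H.tgt z}

/-- The same `χ` serves both sides, so it can be pulled to the front, leaving the hexagon of the
second transformation. The families at the middle places are kept separate since they agree only by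
gluing; once identified, the transports are identities. -/
theorem PreNat.comp_hex (h : PreNat x y φ ψ) (h' : Hex y' z φ' ψ') (hy : y = y')
    (e : G.src y = G.src y') (e' : G.tgt y = G.tgt y') :
    Hex x z (φ ≫ eqToHom e ≫ φ') (ψ ≫ eqToHom e' ≫ ψ') := by
  subst hy
  obtain ⟨χ, h₁, h₂⟩ := h
  simp only [Hex, eqToHom_refl, Category.id_comp, Category.assoc] at h' ⊢
  rw [reassoc_of% h₁, reassoc_of% h₂, h']

theorem PreNat.comp (h : PreNat x y φ ψ) (h' : PreNat y' z φ' ψ') (hy : y = y')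
    (e : G.src y = G.src y') (e' : G.tgt y = G.tgt y') :
    PreNat x z (φ ≫ eqToHom e ≫ φ') (ψ ≫ eqToHom e' ≫ ψ') := by
  subst hy
  obtain ⟨χ, h₁, h₂⟩ := h
  obtain ⟨χ', h₃, h₄⟩ := h'
  refine ⟨χ ≫ χ', ?_, ?_⟩
  · simp only [eqToHom_refl, Category.id_comp, Category.assoc]
    rw [reassoc_of% h₁, h₃]
  · simp only [eqToHom_refl, Category.id_comp, Category.assoc]
    rw [reassoc_of% h₂, h₄]

/-- Here the common `χ` is pushed to the end on both sides, leaving the hexagon of the first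
transformation. -/
theorem Hex.comp_postNat (h : Hex x y φ ψ) (h' : PostNat y' z φ' ψ') (hy : y = y')
    (e : G.src y = G.src y') (e' : G.tgt y = G.tgt y') :
    Hex x z (φ ≫ eqToHom e ≫ φ') (ψ ≫ eqToHom e' ≫ ψ') := by
  subst hy
  obtain ⟨χ, h₁, h₂⟩ := h'
  simp only [Hex, eqToHom_refl, Category.id_comp, Category.assoc] at h ⊢
  rw [h₁, h₂, reassoc_of% h]

end Comp

theorem Hex.tensor {x : (Shape.tensor F H).Place → Arrow B} {y : (Shape.tensor G J).Place → Arrow B}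
    {φ : F.src (fun p => x (.inl p)) ⟶ G.src (fun p => y (.inl p))}
    {ψ : F.tgt (fun p => x (.inl p)) ⟶ G.tgt (fun p => y (.inl p))}
    {φ' : H.src (fun p => x (.inr p)) ⟶ J.src (fun p => y (.inr p))}
    {ψ' : H.tgt (fun p => x (.inr p)) ⟶ J.tgt (fun p => y (.inr p))}
    (h : Hex _ _ φ ψ) (h' : Hex _ _ φ' ψ') :
    Hex (F := .tensor F H) (G := .tensor G J) x y (φ ⊗ₘ φ') (ψ ⊗ₘ ψ') := by
  change (F.toTgt _ ⊗ₘ H.toTgt _) ≫ (ψ ⊗ₘ ψ') ≫ (G.fromTgt _ ⊗ₘ J.fromTgt _) =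
    (F.toSrc _ ⊗ₘ H.toSrc _) ≫ (φ ⊗ₘ φ') ≫ (G.fromSrc _ ⊗ₘ J.fromSrc _)
  simp only [Hex, tensorHom_comp_tensorHom] at h h' ⊢
  rw [h, h']

theorem PreNat.tensor {x : (Shape.tensor F H).Place → Arrow B}
    {y : (Shape.tensor G J).Place → Arrow B}
    {φ : F.src (fun p => x (.inl p)) ⟶ G.src (fun p => y (.inl p))}
    {ψ : F.tgt (fun p => x (.inl p)) ⟶ G.tgt (fun p => y (.inl p))}
    {φ' : H.src (fun p => x (.inr p)) ⟶ J.src (fun p => y (.inr p))}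
    {ψ' : H.tgt (fun p => x (.inr p)) ⟶ J.tgt (fun p => y (.inr p))}
    (h : PreNat _ _ φ ψ) (h' : PreNat _ _ φ' ψ') :
    PreNat (F := .tensor F H) (G := .tensor G J) x y (φ ⊗ₘ φ') (ψ ⊗ₘ ψ') := by
  obtain ⟨χ, h₁, h₂⟩ := h
  obtain ⟨χ', h₃, h₄⟩ := h'
  refine ⟨χ ⊗ₘ χ', ?_, ?_⟩
  · change (F.toTgt _ ⊗ₘ H.toTgt _) ≫ (ψ ⊗ₘ ψ') = (χ ⊗ₘ χ') ≫ (G.toTgt _ ⊗ₘ J.toTgt _)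
    simp only [tensorHom_comp_tensorHom, h₁, h₃]
  · change (F.toSrc _ ⊗ₘ H.toSrc _) ≫ (φ ⊗ₘ φ') = (χ ⊗ₘ χ') ≫ (G.toSrc _ ⊗ₘ J.toSrc _)
    simp only [tensorHom_comp_tensorHom, h₂, h₄]

theorem Hex.plus {x : (Shape.plus F H).Place → Arrow B} {y : (Shape.plus G J).Place → Arrow B}
    {φ : F.src (fun p => x (.inl p)) ⟶ G.src (fun p => y (.inl p))}
    {ψ : F.tgt (fun p => x (.inl p)) ⟶ G.tgt (fun p => y (.inl p))}
    {φ' : H.src (fun p => x (.inr p)) ⟶ J.src (fun p => y (.inr p))}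
    {ψ' : H.tgt (fun p => x (.inr p)) ⟶ J.tgt (fun p => y (.inr p))}
    (h : Hex _ _ φ ψ) (h' : Hex _ _ φ' ψ') :
    Hex (F := .plus F H) (G := .plus G J) x y (sumMap φ φ') (sumMap ψ ψ') := by
  change sumMap (F.toTgt _) (H.toTgt _) ≫ sumMap ψ ψ' ≫ sumMap (G.fromTgt _) (J.fromTgt _) =
    sumMap (F.toSrc _) (H.toSrc _) ≫ sumMap φ φ' ≫ sumMap (G.fromSrc _) (J.fromSrc _)
  simp only [Hex, ← sumMap_comp] at h h' ⊢
  rw [h, h']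

theorem PreNat.plus {x : (Shape.plus F H).Place → Arrow B}
    {y : (Shape.plus G J).Place → Arrow B}
    {φ : F.src (fun p => x (.inl p)) ⟶ G.src (fun p => y (.inl p))}
    {ψ : F.tgt (fun p => x (.inl p)) ⟶ G.tgt (fun p => y (.inl p))}
    {φ' : H.src (fun p => x (.inr p)) ⟶ J.src (fun p => y (.inr p))}
    {ψ' : H.tgt (fun p => x (.inr p)) ⟶ J.tgt (fun p => y (.inr p))}
    (h : PreNat _ _ φ ψ) (h' : PreNat _ _ φ' ψ') :
    PreNat (F := .plus F H) (G := .plus G J) x y (sumMap φ φ') (sumMap ψ ψ') := by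
  obtain ⟨χ, h₁, h₂⟩ := h
  obtain ⟨χ', h₃, h₄⟩ := h'
  refine ⟨sumMap χ χ', ?_, ?_⟩
  · change sumMap (F.toTgt _) (H.toTgt _) ≫ sumMap ψ ψ' =
      sumMap χ χ' ≫ sumMap (G.toTgt _) (J.toTgt _)
    simp only [← sumMap_comp, h₁, h₃]
  · change sumMap (F.toSrc _) (H.toSrc _) ≫ sumMap φ φ' =
      sumMap χ χ' ≫ sumMap (G.toSrc _) (J.toSrc _)
    simp only [← sumMap_comp, h₂, h₄]

theorem Hex.coev_arrow {y₀ : F.Place → Arrow B} {x : G.Place → Arrow B}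
    {w : (Shape.tensor F G).Place → Arrow B} {y : (Shape.arrow F H).Place → Arrow B}
    {φ : (Shape.tensor F G).src w ⟶ H.src fun q => y (.inr q)}
    {ψ : (Shape.tensor F G).tgt w ⟶ H.tgt fun q => y (.inr q)} (h : Hex _ _ φ ψ)
    (hy : ∀ p, y₀ p = y (.inl p)) (hl : ∀ p, y₀ p = w (.inl p)) (hr : ∀ p, x p = w (.inr p))
    (e : (ihom (F.src y₀)).obj (F.src y₀ ⊗ G.src x) =
      (ihom (F.src fun p => y (.inl p))).obj ((Shape.tensor F G).src w))
    (e' : (ihom (F.tgt y₀)).obj (F.tgt y₀ ⊗ G.tgt x) =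
      (ihom (F.tgt fun p => y (.inl p))).obj ((Shape.tensor F G).tgt w)) :
    Hex (F := G) (G := .arrow F H) x y
      ((ihom.coev (F.src y₀)).app (G.src x) ≫ eqToHom e ≫ arrowMap (𝟙 _) φ)
      ((ihom.coev (F.tgt y₀)).app (G.tgt x) ≫ eqToHom e' ≫ arrowMap (𝟙 _) ψ) := by
  obtain rfl : y₀ = fun p => y (.inl p) := funext hy
  obtain rfl : w = Sum.elim (fun p => y (.inl p)) x := by
    funext p; rcases p with p | p
    · exact (hl p).symm
    · exact (hr p).symm
  rw [Hex, Shape.fromTgt_arrow, Shape.fromSrc_arrow]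
  refine (comp_coev_arrowMap_comp _ _ ψ _ _ _).trans (Eq.trans ?_
    (comp_coev_arrowMap_comp _ _ φ _ _ _).symm)
  -- After transposition the two sides differ only in the map under `ihom`, and there they are the
  -- two sides of the given hexagon.
  exact congrArg (fun k => _ ≫ (ihom _).map k ≫ _) h

theorem Hex.ev_tensor {x : (Shape.tensor (.tensor F (.arrow G H)) J).Place → Arrow B}
    {y w : G.Place → Arrow B} {w' : H.Place → Arrow B} {u : (Shape.tensor H J).Place → Arrow B}
    {z : T.Place → Arrow B}
    {φ : F.src (fun p => x (.inl (.inl p))) ⟶ G.src y}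
    {ψ : F.tgt (fun p => x (.inl (.inl p))) ⟶ G.tgt y}
    {φ' : (Shape.tensor H J).src u ⟶ T.src z}
    {ψ' : (Shape.tensor H J).tgt u ⟶ T.tgt z}
    (h : Hex _ _ φ ψ) (h' : Hex _ _ φ' ψ')
    (hy : ∀ p, y p = w p) (hw : ∀ p, x (.inl (.inr (.inl p))) = w p)
    (hw' : ∀ p, x (.inl (.inr (.inr p))) = w' p)
    (hu : ∀ p, w' p = u (.inl p)) (hu' : ∀ p, x (.inr p) = u (.inr p))
    (e₁ : G.src y ⊗ (Shape.arrow G H).src (fun p => x (.inl (.inr p))) =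
      G.src w ⊗ (ihom (G.src w)).obj (H.src w'))
    (e₂ : H.src w' ⊗ J.src (fun p => x (.inr p)) = (Shape.tensor H J).src u)
    (e₁' : G.tgt y ⊗ (Shape.arrow G H).tgt (fun p => x (.inl (.inr p))) =
      G.tgt w ⊗ (ihom (G.tgt w)).obj (H.tgt w'))
    (e₂' : H.tgt w' ⊗ J.tgt (fun p => x (.inr p)) = (Shape.tensor H J).tgt u) :
    Hex (F := .tensor (.tensor F (.arrow G H)) J) x z
      ((((φ ⊗ₘ 𝟙 _) ≫ eqToHom e₁ ≫ (ihom.ev (G.src w)).app (H.src w')) ⊗ₘ 𝟙 _) ≫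
        eqToHom e₂ ≫ φ')
      ((((ψ ⊗ₘ 𝟙 _) ≫ eqToHom e₁' ≫ (ihom.ev (G.tgt w)).app (H.tgt w')) ⊗ₘ 𝟙 _) ≫
        eqToHom e₂' ≫ ψ') := by
  obtain rfl : y = w := funext hy
  obtain rfl : (fun p => x (.inl (.inr (.inl p)))) = y := funext hw
  obtain rfl : (fun p => x (.inl (.inr (.inr p)))) = w' := funext hw'
  obtain rfl : u = Sum.elim (fun p => x (.inl (.inr (.inr p)))) (fun p => x (.inr p)) := by
    funext p; rcases p with p | p
    · exact (hu p).symm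
    · exact (hu' p).symm
  change ((F.toTgt _ ⊗ₘ (Shape.arrow G H).toTgt _) ⊗ₘ J.toTgt _) ≫ _ =
    ((F.toSrc _ ⊗ₘ (Shape.arrow G H).toSrc _) ⊗ₘ J.toSrc _) ≫ _
  rw [Shape.toTgt_arrow, Shape.toSrc_arrow]
  refine (comp_ev_tensor_comp _ ψ _ _ _ _ ψ' _ _ _).trans (Eq.trans ?_
    (comp_ev_tensor_comp _ φ _ _ _ _ φ' _ _ _).symm)
  -- The first hexagon occurs in the argument of the evaluation, the second after the evaluation;
  -- the context is the same on both sides.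
  exact congrArg₂ (fun k l => (((k ⊗ₘ _) ≫ _) ⊗ₘ _) ≫ l) h h'

end Hex

/-! ### Distributivity -/

section Distributivity

variable {B : Type u} [Category.{v} B] [ChosenFiniteCoproducts B]

theorem inl_codiag (X : B) : ChosenFiniteCoproducts.inl X X ≫ codiag X = 𝟙 X :=
  BinaryCofan.IsColimit.inl_desc (ChosenFiniteCoproducts.sumIsCoproduct X X) _ _

theorem inr_codiag (X : B) : ChosenFiniteCoproducts.inr X X ≫ codiag X = 𝟙 X :=
  BinaryCofan.IsColimit.inr_desc (ChosenFiniteCoproducts.sumIsCoproduct X X) _ _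

theorem sum_hom_ext {X Y Z : B} {f g : ChosenFiniteCoproducts.sum X Y ⟶ Z}
    (hl : ChosenFiniteCoproducts.inl X Y ≫ f = ChosenFiniteCoproducts.inl X Y ≫ g)
    (hr : ChosenFiniteCoproducts.inr X Y ≫ f = ChosenFiniteCoproducts.inr X Y ≫ g) : f = g :=
  BinaryCofan.IsColimit.hom_ext (ChosenFiniteCoproducts.sumIsCoproduct X Y) hl hr

theorem sumMap_codiag {X Y : B} (f : X ⟶ Y) : sumMap f f ≫ codiag Y = codiag X ≫ f := by
  apply sum_hom_ext
  · rw [← Category.assoc, inl_sumMap, Category.assoc, inl_codiag, ← Category.assoc, inl_codiag,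
      Category.comp_id, Category.id_comp]
  · rw [← Category.assoc, inr_sumMap, Category.assoc, inr_codiag, ← Category.assoc, inr_codiag,
      Category.comp_id, Category.id_comp]

variable [CartesianMonoidalCategory B] [MonoidalClosed B]

/-- The member of `ξ` at three objects of `B`. -/
def distrib (X Y Z : B) : X ⊗ ChosenFiniteCoproducts.sum Y Z ⟶
    ChosenFiniteCoproducts.sum (X ⊗ Y) (X ⊗ Z) :=
  (𝟙 X ⊗ₘ (sumMap
      ((ihom.coev X).app Y ≫ arrowMap (𝟙 X) (ChosenFiniteCoproducts.inl (X ⊗ Y) (X ⊗ Z)))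
      ((ihom.coev X).app Z ≫ arrowMap (𝟙 X) (ChosenFiniteCoproducts.inr (X ⊗ Y) (X ⊗ Z))) ≫
    codiag _)) ≫ (ihom.ev X).app _

/-- As a left adjoint, `X ⊗ -` preserves the coproduct; concretely, equality can be tested on the
curried maps. -/
theorem tensor_sum_hom_ext {X Y Z W : B} {f g : X ⊗ ChosenFiniteCoproducts.sum Y Z ⟶ W}
    (hl : X ◁ ChosenFiniteCoproducts.inl Y Z ≫ f = X ◁ ChosenFiniteCoproducts.inl Y Z ≫ g)
    (hr : X ◁ ChosenFiniteCoproducts.inr Y Z ≫ f = X ◁ ChosenFiniteCoproducts.inr Y Z ≫ g) :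
    f = g := by
  apply MonoidalClosed.curry_injective
  apply sum_hom_ext
  · rw [← MonoidalClosed.curry_natural_left, ← MonoidalClosed.curry_natural_left, hl]
  · rw [← MonoidalClosed.curry_natural_left, ← MonoidalClosed.curry_natural_left, hr]

theorem inl_distrib (X Y Z : B) :
    X ◁ ChosenFiniteCoproducts.inl Y Z ≫ distrib X Y Z = ChosenFiniteCoproducts.inl _ _ := by
  rw [distrib, id_tensorHom, ← MonoidalCategory.whiskerLeft_comp_assoc, ← Category.assoc,
    inl_sumMap, Category.assoc, inl_codiag, Category.comp_id, coev_arrowMap_ev]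

theorem inr_distrib (X Y Z : B) :
    X ◁ ChosenFiniteCoproducts.inr Y Z ≫ distrib X Y Z = ChosenFiniteCoproducts.inr _ _ := by
  rw [distrib, id_tensorHom, ← MonoidalCategory.whiskerLeft_comp_assoc, ← Category.assoc,
    inr_sumMap, Category.assoc, inr_codiag, Category.comp_id, coev_arrowMap_ev]

/-- Although its definition passes through exponentials with exponent `X`, `distrib` is determined
by its restrictions to the two injections, so it is natural in `X` as well. -/
theorem distrib_naturality {X X' Y Y' Z Z' : B} (f : X ⟶ X') (g : Y ⟶ Y') (h : Z ⟶ Z') :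
    (f ⊗ₘ sumMap g h) ≫ distrib X' Y' Z' =
      distrib X Y Z ≫ sumMap (f ⊗ₘ g) (f ⊗ₘ h) := by
  apply tensor_sum_hom_ext
  · rw [reassoc_of% inl_distrib, inl_sumMap, ← id_tensorHom, tensorHom_comp_tensorHom_assoc,
      inl_sumMap, Category.id_comp, ← inl_distrib X' Y' Z', ← id_tensorHom,
      tensorHom_comp_tensorHom_assoc, Category.comp_id]
  · rw [reassoc_of% inr_distrib, inr_sumMap, ← id_tensorHom, tensorHom_comp_tensorHom_assoc,
      inr_sumMap, Category.id_comp, ← inr_distrib X' Y' Z', ← id_tensorHom,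
      tensorHom_comp_tensorHom_assoc, Category.comp_id]

theorem distrib_eq (X Y Z : B) (e₁ : (ihom X).obj (X ⊗ Y) = (ihom X).obj (X ⊗ Y))
    (e₂ : (ihom X).obj (X ⊗ Z) = (ihom X).obj (X ⊗ Z))
    (e₃ : ChosenFiniteCoproducts.sum
        ((ihom X).obj (ChosenFiniteCoproducts.sum (X ⊗ Y) (X ⊗ Z)))
        ((ihom X).obj (ChosenFiniteCoproducts.sum (X ⊗ Y) (X ⊗ Z))) =
      ChosenFiniteCoproducts.sum
        ((ihom X).obj (ChosenFiniteCoproducts.sum (X ⊗ Y) (X ⊗ Z)))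
        ((ihom X).obj (ChosenFiniteCoproducts.sum (X ⊗ Y) (X ⊗ Z))))
    (e₄ : X ⊗ (ihom X).obj (ChosenFiniteCoproducts.sum (X ⊗ Y) (X ⊗ Z)) =
      X ⊗ (ihom X).obj (ChosenFiniteCoproducts.sum (X ⊗ Y) (X ⊗ Z)))
    (e : ChosenFiniteCoproducts.sum (X ⊗ Y) (X ⊗ Z) =
      ChosenFiniteCoproducts.sum (X ⊗ Y) (X ⊗ Z)) :
    (𝟙 X ⊗ₘ (sumMap
        ((ihom.coev X).app Y ≫ eqToHom e₁ ≫
          arrowMap (𝟙 X) (ChosenFiniteCoproducts.inl (X ⊗ Y) (X ⊗ Z)))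
        ((ihom.coev X).app Z ≫ eqToHom e₂ ≫
          arrowMap (𝟙 X) (ChosenFiniteCoproducts.inr (X ⊗ Y) (X ⊗ Z))) ≫
      eqToHom e₃ ≫ codiag _)) ≫ eqToHom e₄ ≫ (ihom.ev X).app _ =
    distrib X Y Z ≫ eqToHom e := by
  simp only [eqToHom_refl, Category.id_comp, Category.comp_id, distrib]

end Distributivity

/-! ### The amalgamated graph and the members of `ξ` -/

variable {F G H J T : Shape}

/-- The identifications between the values of a family on the components of the constituents of
`ξ` that are forced by the amalgamations. -/
structure XiGluing {C : Type*} (X X₂ X₃ X₅ X₆ X₈ X₉ : F.Place → C) (Y : G.Place → C)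
    (Z : H.Place → C) (K₄ K₇ K₈ K₉ : (Shape.plus (.tensor F G) (.tensor F H)).Place → C) :
    Prop where
  inl_arrow : X₂ = X₃
  inl_tensor : Sum.elim X₂ Y = fun p => K₄ (.inl p)
  inr_arrow : X₅ = X₆
  inr_tensor : Sum.elim X₅ Z = fun p => K₇ (.inr p)
  codiag_inl : X₃ = X₈
  codiag_inl' : K₄ = K₈
  codiag_inr : X₆ = X₈
  codiag_inr' : K₇ = K₈
  ev : X = X₉
  ev_arrow : X₈ = X₉
  ev_arrow' : K₈ = K₉

/-- Each injection fixes only its own summand of the target; the codiagonal merges the two copies,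
so together they determine all of it. The values lie in an arbitrary type because the result is
needed both for objects and for arrows. -/
theorem XiGluing.target {C : Type*} {X X₂ X₃ X₅ X₆ X₈ X₉ : F.Place → C} {Y : G.Place → C}
    {Z : H.Place → C} {K₄ K₇ K₈ K₉ : (Shape.plus (.tensor F G) (.tensor F H)).Place → C}
    (h : XiGluing X X₂ X₃ X₅ X₆ X₈ X₉ Y Z K₄ K₇ K₈ K₉) :
    K₉ = Sum.elim (Sum.elim X Y) (Sum.elim X Z) := by
  obtain ⟨rfl, h₁, rfl, h₂, rfl, rfl, rfl, rfl, rfl, rfl, rfl⟩ := h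
  funext p
  rcases p with p | p
  · exact (congrFun h₁ p).symm
  · exact (congrFun h₂ p).symm

/-- The members of `ξ`, with the objects of all components of its constituents as parameters. -/
theorem XiGluing.members {X X₂ X₃ X₅ X₆ X₈ X₉ : F.Place → B} {Y : G.Place → B} {Z : H.Place → B}
    {K₄ K₇ K₈ K₉ : (Shape.plus (.tensor F G) (.tensor F H)).Place → B}
    (h : XiGluing X X₂ X₃ X₅ X₆ X₈ X₉ Y Z K₄ K₇ K₈ K₉)
    (e₁ : (ihom (F.eval X₂)).obj (F.eval X₂ ⊗ G.eval Y) =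
      (ihom (F.eval X₃)).obj ((Shape.tensor F G).eval fun p => K₄ (.inl p)))
    (e₂ : (ihom (F.eval X₅)).obj (F.eval X₅ ⊗ H.eval Z) =
      (ihom (F.eval X₆)).obj ((Shape.tensor F H).eval fun p => K₇ (.inr p)))
    (e₃ : ChosenFiniteCoproducts.sum
        ((ihom (F.eval X₃)).obj ((Shape.plus (.tensor F G) (.tensor F H)).eval K₄))
        ((ihom (F.eval X₆)).obj ((Shape.plus (.tensor F G) (.tensor F H)).eval K₇)) =
      ChosenFiniteCoproducts.sum
        ((ihom (F.eval X₈)).obj ((Shape.plus (.tensor F G) (.tensor F H)).eval K₈))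
        ((ihom (F.eval X₈)).obj ((Shape.plus (.tensor F G) (.tensor F H)).eval K₈)))
    (e₄ : F.eval X ⊗ (ihom (F.eval X₈)).obj ((Shape.plus (.tensor F G) (.tensor F H)).eval K₈) =
      F.eval X₉ ⊗ (ihom (F.eval X₉)).obj ((Shape.plus (.tensor F G) (.tensor F H)).eval K₉))
    (e : ChosenFiniteCoproducts.sum (F.eval X ⊗ G.eval Y) (F.eval X ⊗ H.eval Z) =
      (Shape.plus (.tensor F G) (.tensor F H)).eval K₉) :
    (𝟙 (F.eval X) ⊗ₘ (sumMap
        ((ihom.coev (F.eval X₂)).app (G.eval Y) ≫ eqToHom e₁ ≫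
          arrowMap (𝟙 (F.eval X₃)) (ChosenFiniteCoproducts.inl
            ((Shape.tensor F G).eval fun p => K₄ (.inl p))
            ((Shape.tensor F H).eval fun p => K₄ (.inr p))))
        ((ihom.coev (F.eval X₅)).app (H.eval Z) ≫ eqToHom e₂ ≫
          arrowMap (𝟙 (F.eval X₆)) (ChosenFiniteCoproducts.inr
            ((Shape.tensor F G).eval fun p => K₇ (.inl p))
            ((Shape.tensor F H).eval fun p => K₇ (.inr p)))) ≫
      eqToHom e₃ ≫ codiag _)) ≫ eqToHom e₄ ≫
      (ihom.ev (F.eval X₉)).app ((Shape.plus (.tensor F G) (.tensor F H)).eval K₉) =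
    distrib (F.eval X) (G.eval Y) (H.eval Z) ≫ eqToHom e := by
  -- The two tensor equations constrain only halves of `K₄` and `K₇` and cannot be substituted. The
  -- explicit form of `K₉` replaces them, after which the remaining equations identify variables and
  -- every transport is an identity.
  obtain rfl := h.target
  obtain ⟨rfl, -, rfl, -, rfl, rfl, rfl, rfl, rfl, rfl, rfl⟩ := h
  exact distrib_eq _ _ _ _ _ _ _ _

namespace CTrans

/-- A labelling of the components of the amalgamation takes one value at the two components meeting
in a middle place. -/
theorem comp_glue {α : CTrans B F G} {β : CTrans B G H} {C : Type*}
    (a : (β.comp α).graph.Comp → C) (q : G.Place) :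
    a (Quot.mk _ (.inl (α.graph.right q))) = a (Quot.mk _ (.inr (β.graph.left q))) :=
  congrArg a (Quot.sound (.middle q))

theorem xi_gluing {C : Type*} (a : (xi B F G H).graph.Comp → C) :
    XiGluing (F := F) (G := G) (H := H)
    (fun p => a (Quot.mk _ (.inl (.inl p))))
    (fun p => a (Quot.mk _ (.inl (.inr (Quot.mk _ (.inl (.inl (Quot.mk _ (.inl (.inl p))))))))))
    (fun p => a (Quot.mk _ (.inl (.inr (Quot.mk _ (.inl (.inl (Quot.mk _ (.inr (.inl p))))))))))
    (fun p => a (Quot.mk _ (.inl (.inr (Quot.mk _ (.inl (.inr (Quot.mk _ (.inl (.inl p))))))))))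
    (fun p => a (Quot.mk _ (.inl (.inr (Quot.mk _ (.inl (.inr (Quot.mk _ (.inr (.inl p))))))))))
    (fun p => a (Quot.mk _ (.inl (.inr (Quot.mk _ (.inr (.inl p)))))))
    (fun p => a (Quot.mk _ (.inr (.inl p))))
    (fun p => a ((xi B F G H).graph.left (.inr (.inl p))))
    (fun p => a ((xi B F G H).graph.left (.inr (.inr p))))
    (fun p => a (Quot.mk _ (.inl (.inr (Quot.mk _ (.inl (.inl (Quot.mk _ (.inr (.inr p))))))))))
    (fun p => a (Quot.mk _ (.inl (.inr (Quot.mk _ (.inl (.inr (Quot.mk _ (.inr (.inr p))))))))))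
    (fun p => a (Quot.mk _ (.inl (.inr (Quot.mk _ (.inr (.inr p)))))))
    (fun p => a (Quot.mk _ (.inr (.inr p)))) := by
  let K := Shape.plus (.tensor F G) (.tensor F H)
  let l := ((one B F).arrow (inl B (.tensor F G) (.tensor F H))).comp (coev B F G)
  let r := ((one B F).arrow (inr B (.tensor F G) (.tensor F H))).comp (coev B F H)
  let b : ((codiag B (.arrow F K)).comp (l.plus r)).graph.Comp → C :=
    fun c => a (Quot.mk _ (.inl (.inr c)))
  let bl : l.graph.Comp → C := fun c => b (Quot.mk _ (.inl (.inl c)))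
  let br : r.graph.Comp → C := fun c => b (Quot.mk _ (.inl (.inr c)))
  exact
  { inl_arrow := funext fun p => comp_glue bl (.inl p)
    inl_tensor := by
      funext p
      rcases p with p | p
      · exact comp_glue bl (.inr (.inl p))
      · exact comp_glue bl (.inr (.inr p))
    inr_arrow := funext fun p => comp_glue br (.inl p)
    inr_tensor := by
      funext p
      rcases p with p | p
      · exact comp_glue br (.inr (.inl p))
      · exact comp_glue br (.inr (.inr p))
    codiag_inl := funext fun p => comp_glue b (.inl (.inl p))
    codiag_inl' := funext fun p => comp_glue b (.inl (.inr p))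
    codiag_inr := funext fun p => comp_glue b (.inr (.inl p))
    codiag_inr' := funext fun p => comp_glue b (.inr (.inr p))
    ev := funext fun p => comp_glue a (.inl p)
    ev_arrow := funext fun p => comp_glue a (.inr (.inl p))
    ev_arrow' := funext fun p => comp_glue a (.inr (.inr p)) }

theorem xi_app (A : (xi B F G H).graph.Comp → B)
    (e : ChosenFiniteCoproducts.sum
      (F.eval (fun p => A ((xi B F G H).graph.left (.inl p))) ⊗
        G.eval (fun p => A ((xi B F G H).graph.left (.inr (.inl p)))))
      (F.eval (fun p => A ((xi B F G H).graph.left (.inl p))) ⊗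
        H.eval (fun p => A ((xi B F G H).graph.left (.inr (.inr p))))) =
      (Shape.plus (.tensor F G) (.tensor F H)).eval fun q => A ((xi B F G H).graph.right q)) :
    (xi B F G H).app A =
      distrib (F.eval fun p => A ((xi B F G H).graph.left (.inl p)))
        (G.eval fun p => A ((xi B F G H).graph.left (.inr (.inl p))))
        (H.eval fun p => A ((xi B F G H).graph.left (.inr (.inr p)))) ≫ eqToHom e :=
  (xi_gluing A).members _ _ _ _ _

end CTrans

theorem preNat_distrib {x : (Shape.tensor F (.plus G H)).Place → Arrow B}
    {y : (Shape.plus (.tensor F G) (.tensor F H)).Place → Arrow B}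
    (hy : y = Sum.elim (Sum.elim (fun p => x (.inl p)) (fun p => x (.inr (.inl p))))
      (Sum.elim (fun p => x (.inl p)) (fun p => x (.inr (.inr p)))))
    (e : ChosenFiniteCoproducts.sum
      ((F.src fun p => x (.inl p)) ⊗ G.src fun p => x (.inr (.inl p)))
      ((F.src fun p => x (.inl p)) ⊗ H.src fun p => x (.inr (.inr p))) = Shape.src _ y)
    (e' : ChosenFiniteCoproducts.sum
      ((F.tgt fun p => x (.inl p)) ⊗ G.tgt fun p => x (.inr (.inl p)))
      ((F.tgt fun p => x (.inl p)) ⊗ H.tgt fun p => x (.inr (.inr p))) = Shape.tgt _ y) :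
    PreNat (F := .tensor F (.plus G H)) x y
      (distrib (F.src fun p => x (.inl p)) (G.src fun p => x (.inr (.inl p)))
        (H.src fun p => x (.inr (.inr p))) ≫ eqToHom e)
      (distrib (F.tgt fun p => x (.inl p)) (G.tgt fun p => x (.inr (.inl p)))
        (H.tgt fun p => x (.inr (.inr p))) ≫ eqToHom e') := by
  subst hy
  have key : ∀ {V W : B} (f : V ⟶ W) (e : W = W), f ≫ eqToHom e = f := fun f _ => by simp
  -- The required extension is `distrib` at the mixed values.
  refine ⟨distrib _ _ _, ?_, ?_⟩
  · exact (congrArg _ (key _ _)).trans (distrib_naturality (F.toTgt _) (G.toTgt _) (H.toTgt _))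
  · exact (congrArg _ (key _ _)).trans (distrib_naturality (F.toSrc _) (G.toSrc _) (H.toSrc _))

/-! ### Hexagons and naturality of transformations -/

namespace CTrans

/-- The hexagons commute for all families of arrows indexed by the components. -/
def Full (α : CTrans B F G) : Prop :=
  ∀ a : α.graph.Comp → Arrow B,
    Hex (fun p => a (α.graph.left p)) (fun q => a (α.graph.right q))
      (α.app fun c => (a c).left) (α.app fun c => (a c).right)

/-- Naturality in all argument places, with the mixed families evaluated before the
transformation. -/
def Pre (α : CTrans B F G) : Prop :=
  ∀ a : α.graph.Comp → Arrow B,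
    PreNat (fun p => a (α.graph.left p)) (fun q => a (α.graph.right q))
      (α.app fun c => (a c).left) (α.app fun c => (a c).right)

/-- Naturality in all argument places, with the mixed families evaluated after the
transformation. -/
def Post (α : CTrans B F G) : Prop :=
  ∀ a : α.graph.Comp → Arrow B,
    PostNat (fun p => a (α.graph.left p)) (fun q => a (α.graph.right q))
      (α.app fun c => (a c).left) (α.app fun c => (a c).right)

/-- The single-component hexagon is the one for the family with `f` at `c` and identities elsewhere.
-/
theorem Full.gDinatural {α : CTrans B F G} (h : α.Full) : α.GDinatural :=
  fun c A _ _ f => h fun k => Arrow.mk (updateHom A c f k)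

theorem Pre.full {α : CTrans B F G} (h : α.Pre) : α.Full := fun a => (h a).hex

theorem Post.full {α : CTrans B F G} (h : α.Post) : α.Full := fun a => (h a).hex

theorem Pre.comp_full {α : CTrans B F G} {β : CTrans B G H} (h : α.Pre) (h' : β.Full) :
    (β.comp α).Full := fun a =>
  (h fun c => a (Quot.mk _ (.inl c))).comp_hex (h' fun c => a (Quot.mk _ (.inr c)))
    (funext fun q => comp_glue a q) _ _

theorem Pre.comp {α : CTrans B F G} {β : CTrans B G H} (h : α.Pre) (h' : β.Pre) :
    (β.comp α).Pre := fun a =>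
  PreNat.comp (h fun c => a (Quot.mk _ (.inl c))) (h' fun c => a (Quot.mk _ (.inr c)))
    (funext fun q => comp_glue a q) _ _

theorem Full.comp_post {α : CTrans B F G} {β : CTrans B G H} (h : α.Full) (h' : β.Post) :
    (β.comp α).Full := fun a =>
  (h fun c => a (Quot.mk _ (.inl c))).comp_postNat (h' fun c => a (Quot.mk _ (.inr c)))
    (funext fun q => comp_glue a q) _ _

theorem Full.tensor {α : CTrans B F G} {β : CTrans B H J} (h : α.Full) (h' : β.Full) :
    (α.tensor β).Full := fun a =>
  Hex.tensor (h fun c => a (.inl c)) (h' fun c => a (.inr c))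

theorem Pre.tensor {α : CTrans B F G} {β : CTrans B H J} (h : α.Pre) (h' : β.Pre) :
    (α.tensor β).Pre := fun a =>
  PreNat.tensor (h fun c => a (.inl c)) (h' fun c => a (.inr c))

theorem Full.plus {α : CTrans B F G} {β : CTrans B H J} (h : α.Full) (h' : β.Full) :
    (α.plus β).Full := fun a =>
  Hex.plus (h fun c => a (.inl c)) (h' fun c => a (.inr c))

theorem Pre.plus {α : CTrans B F G} {β : CTrans B H J} (h : α.Pre) (h' : β.Pre) :
    (α.plus β).Pre := fun a =>
  PreNat.plus (h fun c => a (.inl c)) (h' fun c => a (.inr c))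

theorem pre_xi (F G H : Shape) : (xi B F G H).Pre := by
  intro a
  have hy := (xi_gluing a).target
  have e : ∀ A : (xi B F G H).graph.Comp → B, _ := fun A =>
    congrArg (Shape.plus (.tensor F G) (.tensor F H)).eval (xi_gluing A).target.symm
  rw [xi_app _ (e _), xi_app _ (e _)]
  exact preNat_distrib hy _ _

/-- The unit is only dinatural in `F`, so the composition lemmas do not apply and the hexagon is
transposed as a whole. -/
theorem Full.curry {α : CTrans B (.tensor F G) H} (h : α.Full) :
    (((one B F).arrow α).comp (coev B F G)).Full := fun a =>
  Hex.coev_arrow (h fun c => a (Quot.mk _ (.inr (.inr c))))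
    (fun p => comp_glue a (.inl p))
    (fun p => comp_glue a (.inr (.inl p)))
    (fun p => comp_glue a (.inr (.inr p))) _ _

theorem Full.apply {α : CTrans B F G} {β : CTrans B (.tensor H J) T} (h : α.Full) (h' : β.Full) :
    (β.comp (((ev B G H).comp (α.tensor (one B (.arrow G H)))).tensor (one B J))).Full := by
  intro a
  -- The restriction to the inner composite supplies the gluing at the argument of the evaluation;
  -- `a` itself supplies the gluing at the source of `β`.
  let b : ((ev B G H).comp (α.tensor (one B (.arrow G H)))).graph.Comp → Arrow B :=
    fun c => a (Quot.mk _ (.inl (.inl c)))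
  exact Hex.ev_tensor (h fun c => b (Quot.mk _ (.inl (.inl c))))
    (h' fun c => a (Quot.mk _ (.inr c)))
    (fun p => comp_glue b (.inl p))
    (fun p => comp_glue b (.inr (.inl p)))
    (fun p => comp_glue b (.inr (.inr p)))
    (hu := fun p => comp_glue a (.inl p))
    (hu' := fun p => comp_glue a (.inr p)) _ _ _ _

/-! ### Primitive transformations -/

theorem pre_one (F : Shape) : (one B F).Pre := fun _ =>
  ⟨𝟙 _, (Category.comp_id _).trans (Category.id_comp _).symm,
    (Category.comp_id _).trans (Category.id_comp _).symm⟩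

theorem pre_delta (F : Shape) : (delta B F).Pre := by
  have key : ∀ {X Y : B} (f : X ⟶ Y), (f ⊗ₘ 𝟙 (𝟙_ B)) ≫ (ρ_ Y).hom = (ρ_ X).hom ≫ f := by simp
  exact fun a => ⟨(ρ_ (F.inMix a)).hom, key (F.toTgt a), key (F.toSrc a)⟩

theorem pre_deltaInv (F : Shape) : (deltaInv B F).Pre := by
  have key : ∀ {X Y : B} (f : X ⟶ Y), f ≫ (ρ_ Y).inv = (ρ_ X).inv ≫ (f ⊗ₘ 𝟙 (𝟙_ B)) := by simp
  exact fun a => ⟨(ρ_ (F.inMix a)).inv, key (F.toTgt a), key (F.toSrc a)⟩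

theorem pre_assoc (F G H : Shape) : (assoc B F G H).Pre := fun a =>
  ⟨(α_ (F.inMix fun p => a (.inl p)) (G.inMix fun p => a (.inr (.inl p)))
      (H.inMix fun p => a (.inr (.inr p)))).inv,
    associator_inv_naturality (F.toTgt _) (G.toTgt _) (H.toTgt _),
    associator_inv_naturality (F.toSrc _) (G.toSrc _) (H.toSrc _)⟩

theorem pre_assocInv (F G H : Shape) : (assocInv B F G H).Pre := fun a =>
  ⟨(α_ (F.inMix fun p => a (.inl p)) (G.inMix fun p => a (.inr (.inl p)))
      (H.inMix fun p => a (.inr (.inr p)))).hom,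
    associator_naturality (F.toTgt _) (G.toTgt _) (H.toTgt _),
    associator_naturality (F.toSrc _) (G.toSrc _) (H.toSrc _)⟩

theorem pre_swap (F G : Shape) : (swap B F G).Pre := by
  have key : ∀ {X X' Y Y' : B} (f : X ⟶ X') (g : Y ⟶ Y'),
      (f ⊗ₘ g) ≫ lift (snd X' Y') (fst X' Y') = lift (snd X Y) (fst X Y) ≫ (g ⊗ₘ f) := by
    intros; ext <;> simp
  exact fun a => ⟨lift (snd _ _) (fst _ _), key (F.toTgt _) (G.toTgt _),
    key (F.toSrc _) (G.toSrc _)⟩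

theorem pre_diag (F : Shape) : (diag B F).Pre := by
  have key : ∀ {X Y : B} (f : X ⟶ Y), f ≫ lift (𝟙 Y) (𝟙 Y) = lift (𝟙 X) (𝟙 X) ≫ (f ⊗ₘ f) := by
    intros; ext <;> simp
  exact fun a => ⟨lift (𝟙 _) (𝟙 _), key (F.toTgt _), key (F.toSrc _)⟩

theorem pre_toUnit (F : Shape) : (toUnit B F).Pre := fun _ =>
  ⟨SemiCartesianMonoidalCategory.toUnit _, toUnit_unique _ _, toUnit_unique _ _⟩

theorem pre_ofZero (F : Shape) : (ofZero B F).Pre := fun _ =>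
  ⟨ChosenFiniteCoproducts.zeroIsInitial.to _, ChosenFiniteCoproducts.zeroIsInitial.hom_ext _ _,
    ChosenFiniteCoproducts.zeroIsInitial.hom_ext _ _⟩

theorem post_codiag (F : Shape) : (codiag B F).Post := fun _ =>
  ⟨GDinat.codiag _, (sumMap_codiag (F.fromTgt _)).symm, (sumMap_codiag (F.fromSrc _)).symm⟩

theorem post_inl (F G : Shape) : (inl B F G).Post := fun _ =>
  ⟨ChosenFiniteCoproducts.inl _ _, inl_sumMap (F.fromTgt _) (G.fromTgt _),
    inl_sumMap (F.fromSrc _) (G.fromSrc _)⟩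

theorem post_inr (F G : Shape) : (inr B F G).Post := fun _ =>
  ⟨ChosenFiniteCoproducts.inr _ _, inr_sumMap (F.fromTgt _) (G.fromTgt _),
    inr_sumMap (F.fromSrc _) (G.fromSrc _)⟩

/-- Once the exponent map is moved to the other factor, the two sides agree by the squares of `F`
and of `G`. -/
theorem full_ev (F G : Shape) : (ev B F G).Full := by
  intro a
  change (F.toTgt _ ⊗ₘ (Shape.arrow F G).toTgt _) ≫ _ =
    (F.toSrc _ ⊗ₘ (Shape.arrow F G).toSrc _) ≫ _
  rw [Shape.toTgt_arrow, Shape.toSrc_arrow]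
  refine (tensorHom_comp_arrowMap_ev _ _ _ _ _).trans (Eq.trans ?_
    (tensorHom_comp_arrowMap_ev _ _ _ _ _).symm)
  exact congrArg₂ (fun k l => (k ⊗ₘ _) ≫ _ ≫ l) (F.toTgt_fromTgt _) (G.toTgt_fromTgt _)

theorem full_coev (F G : Shape) : (coev B F G).Full := by
  intro a
  change _ ≫ _ ≫ (Shape.arrow F (.tensor F G)).fromTgt (B := B)
      (fun q => a ((coev B F G).graph.right q)) =
    _ ≫ _ ≫ (Shape.arrow F (.tensor F G)).fromSrc (fun q => a ((coev B F G).graph.right q))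
  rw [Shape.fromTgt_arrow, Shape.fromSrc_arrow]
  refine (comp_coev_arrowMap _ _ _ _).trans (Eq.trans ?_ (comp_coev_arrowMap _ _ _ _).symm)
  -- Under the transpose only the square of `F ⊗ G` remains.
  exact congrArg (fun k => _ ≫ (ihom _).map k ≫ _)
    ((Shape.tensor F G).toTgt_fromTgt (Sum.elim (fun p => a (.inl p)) (fun p => a (.inr p))))

end CTrans

/-! ### Induction over the constructible transformations -/

theorem Primitive.full {α : CTrans B F G} (h : Primitive α) : α.Full := by
  cases h with
  | one => exact (CTrans.pre_one _).full
  | delta => exact (CTrans.pre_delta _).full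
  | deltaInv => exact (CTrans.pre_deltaInv _).full
  | assoc => exact (CTrans.pre_assoc _ _ _).full
  | assocInv => exact (CTrans.pre_assocInv _ _ _).full
  | swap => exact (CTrans.pre_swap _ _).full
  | diag => exact (CTrans.pre_diag _).full
  | toUnit => exact (CTrans.pre_toUnit _).full
  | codiag => exact (CTrans.post_codiag _).full
  | ofZero => exact (CTrans.pre_ofZero _).full
  | inl => exact (CTrans.post_inl _ _).full
  | inr => exact (CTrans.post_inr _ _).full
  | ev => exact CTrans.full_ev _ _
  | coev => exact CTrans.full_coev _ _

theorem Structural.pre {α : CTrans B F G} (h : Structural α) : α.Pre := by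
  cases h with
  | delta => exact CTrans.pre_delta _
  | deltaInv => exact CTrans.pre_deltaInv _
  | assoc => exact CTrans.pre_assoc _ _ _
  | assocInv => exact CTrans.pre_assocInv _ _ _
  | swap => exact CTrans.pre_swap _ _
  | diag => exact CTrans.pre_diag _
  | toUnit => exact CTrans.pre_toUnit _

theorem Whiskered.pre {β : CTrans B H J} (hβ : β.Pre) {α : CTrans B F G} (h : Whiskered β α) :
    α.Pre := by
  induction h with
  | base => exact hβ
  | right K _ ih => exact ih.tensor (CTrans.pre_one K)
  | left K _ ih => exact (CTrans.pre_one K).tensor ih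

theorem Constructible.full {α : CTrans B F G} (h : Constructible α) : α.Full := by
  induction h with
  | primitive h => exact h.full
  | structural h h' _ ih => exact (h'.pre h.pre).comp_full ih
  | tensor _ _ ih ih' => exact ih.tensor ih'
  | cases _ _ ih ih' =>
    -- Everything applied before `α ⊕ β` is natural on the source side and the codiagonal after it
    -- on the target side, so only one genuine hexagon has to be carried through.
    exact ((((CTrans.pre_swap _ _).comp (CTrans.pre_xi _ _ _)).comp
      ((CTrans.pre_swap _ _).plus (CTrans.pre_swap _ _))).comp_full
      (ih.plus ih')).comp_post (CTrans.post_codiag _)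
  | inl _ _ ih => exact ih.comp_post (CTrans.post_inl _ _)
  | inr _ _ ih => exact ih.comp_post (CTrans.post_inr _ _)
  | curry _ ih => exact ih.curry
  | apply _ _ ih ih' => exact ih.apply ih'

end GDinat

theorem lemma3p13 {B : Type u} [Category.{v} B] [CartesianMonoidalCategory B] [MonoidalClosed B]
    [ChosenFiniteCoproducts B] {F G : GDinat.Shape} (α : GDinat.CTrans B F G)
    (hα : GDinat.Constructible α) : α.GDinatural := hα.full.gDinatural
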